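/- Let $\Sigma$ be a finite set of events, $\checkmark\notin\Sigma$. CSP terms are built from $\mathrm{STOP}$, $\mathrm{SKIP}$, $\mathrm{DIV}$, variables $X$, prefix $a\to P$, internal and external choice $P\sqcap Q$, $P\mathbin{\Box}Q$, parallel composition $P\parallel_A Q$ (synchronising on $A\subseteq\Sigma$ and on $\checkmark$), sequential composition $P;Q$, hiding $P\setminus A$, renaming $P[R]$ by a relation $R\subseteq\Sigma\times\Sigma$, and recursion $\mu X.P$. Closed terms are called processes. *Semantics.* A process $P$ denotes a pair $(\mathrm{traces}_\perp(P),\mathrm{divergences}(P))$ in the standard CSP finite-traces/divergences model $\mathcal T^{\Downarrow}$ (divergence is catastrophic; $\mu X.P$ is the least fixed point with respect to componentwise reverse inclusion). $P$ is *livelock-free* if $\mathrm{divergences}(P)=\emptyset$. An *infinite trace* of $P$ is a sequence $u\in\Sigma^\omega$ all of whose finite prefixes are traces of $P$. A sequence $u\in\Sigma^\omega$ is *fair* in $F\subseteq\Sigma$ if every $a\in F$ occurs infinitely often in $u$, and *co-fair* in $C\subseteq\Sigma$ if every $b\in C$ occurs only finitely often in $u$. The process $P$ also has a labelled transition system $M_P$,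 consisting of the states reachable from $P$ by the standard structural operational semantics, with labels in $\Sigma\cup\{\checkmark,\tau\}$. *Structurally finite-state processes.* $\mathrm{STOP}$, $\mathrm{SKIP}$ and variables are *sequential*; if $P,Q$ are sequential, so are $a\to P$, $P\sqcap Q$, $P\mathbin{\Box}Q$, $\mu X.P$ and, provided that $P$ is closed, $P;Q$, $P\setminus A$, $P[R]$. A closed sequential term is called a sequential process. The *structurally finite-state* processes are the least class that contains all sequential processes and is closed under $a\to P$, $P\sqcap Q$, $P\mathbin{\Box}Q$, $P\parallel_A Q$, $P;Q$, $P\setminus A$, $P[R]$. *The flag $\delta$ and the pairs $\Phi$.* To each structurally finite-state process $P$ assign $\delta(P)\in\{\mathrm{true},\mathrm{false}\}$ and $\Phi(P)\subseteq\mathcal P(\Sigma)\times\mathcal P(\Sigma)$ recursively as follows. If $P$ is a sequential process, then $\delta(P)=\mathrm{true}$ iff some state of $M_P$ has an infinite path of $\tau$-transitions (for finite $M_P$: iff $M_P$ has a $\tau$-cycle), and $\Phi(P)$ is the set of all pairs $(L,\Sigma\setminus L)$ with $\emptyset\ne L\subseteq\Sigma$ such that, after deleting all $(\Sigma\setminus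 L)$-labelled transitions from $M_P$, some strongly connected component contains, for every $a\in L$, an $a$-labelled transition. Otherwise: - $\delta(a\to P)=\delta(P)$ and $\Phi(a\to P)=\Phi(P)$; - $\delta(P_1\oplus P_2)=\delta(P_1)\lor\delta(P_2)$ for $\oplus\in\{\sqcap,\Box,;,\parallel_A\}$, and $\Phi(P_1\oplus P_2)=\Phi(P_1)\cup\Phi(P_2)$ for $\oplus\in\{\sqcap,\Box,;\}$; - $\Phi(P_1\parallel_A P_2)$ consists of the pairs $(F,C)$ with $F\cap C=\emptyset$, $F=F_1\cup F_2$ and $C=(C_1\cap A)\cup(C_2\cap A)\cup((C_1\setminus A)\cap(C_2\setminus A))$ for some $(F_i,C_i)\in\Phi(P_i)$, $i=1,2$, together with the pairs $(F,C)\in\Phi(P_1)\cup\Phi(P_2)$ with $F\cap A=\emptyset$; - $\delta(P\setminus A)=\mathrm{false}$ iff $\delta(P)=\mathrm{false}$ and $F\setminus A\neq\emptyset$ for every $(F,C)\in\Phi(P)$; and $\Phi(P\setminus A)=\{(F\setminus A,\,C\cup A) : (F,C)\in\Phi(P)\}$; - $\delta(P[R])=\delta(P)$, and $\Phi(P[R])$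 consists of the pairs $(F,C)$ such that, for some $(F',C')\in\Phi(P)$, $F'\subseteq R^{-1}(F)$, $F\subseteq R(F')$ and $C=\{b\in\Sigma : R^{-1}(b)\subseteq C'\}$. **Theorem.** Let $P$ be a structurally finite-state process with $\delta(P)=\mathrm{false}$. Then $P$ is livelock-free. Moreover, for every infinite trace $u$ of $P$ there is a pair $(F,C)\in\Phi(P)$ such that $u$ is both fair in $F$ and co-fair in $C$. -/

import Mathlib

namespace CSP

universe u

/-- CSP terms over the alphabet `α`; variables are drawn from the infinite set `ℕ`. -/
inductive Term (α : Type u) : Type u where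
  | STOP : Term α
  | SKIP : Term α
  | DIV : Term α
  | var (X : ℕ) : Term α
  | pre (a : α) (P : Term α) : Term α
  | intChoice (P Q : Term α) : Term α
  | extChoice (P Q : Term α) : Term α
  | par (A : Set α) (P Q : Term α) : Term α
  | seq (P Q : Term α) : Term α
  | hide (P : Term α) (A : Set α) : Term α
  | rename (P : Term α) (R : α → α → Prop) : Term α
  | mu (X : ℕ) (P : Term α) : Term α

namespace Term

variable {α : Type u}

/-- Free variables. -/
def fv : Term α → Set ℕ
  | STOP => ∅
  | SKIP => ∅
  | DIV => ∅
  | var X => {X}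
  | pre _ P => fv P
  | intChoice P Q => fv P ∪ fv Q
  | extChoice P Q => fv P ∪ fv Q
  | par _ P Q => fv P ∪ fv Q
  | seq P Q => fv P ∪ fv Q
  | hide P _ => fv P
  | rename P _ => fv P
  | mu X P => fv P \ {X}

/-- Closed terms, i.e. processes. -/
def Closed (P : Term α) : Prop := fv P = ∅

/-- `subst X Q P` is `[Q/X]P`. It is only used for closed `Q`, so there is no variable capture. -/
def subst (X : ℕ) (Q : Term α) : Term α → Term α
  | STOP => STOP
  | SKIP => SKIP
  | DIV => DIV
  | var Y => if Y = X then Q else var Y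
  | pre a P => pre a (subst X Q P)
  | intChoice P P' => intChoice (subst X Q P) (subst X Q P')
  | extChoice P P' => extChoice (subst X Q P) (subst X Q P')
  | par A P P' => par A (subst X Q P) (subst X Q P')
  | seq P P' => seq (subst X Q P) (subst X Q P')
  | hide P A => hide (subst X Q P) A
  | rename P R => rename (subst X Q P) R
  | mu Y P => if Y = X then mu Y P else mu Y (subst X Q P)

end Term

/-! ### Operational semantics -/

/-- Transition labels: the silent event, successful termination, and the events of `α`. -/
inductive Label (α : Type u) : Type u where
  | tau : Label α
  | tick : Label α
  | ev (a : α) : Label α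

/-- The label `γ` is an event of the set `A`. -/
def Label.In {α : Type u} (A : Set α) : Label α → Prop
  | .tau => False
  | .tick => False
  | .ev a => a ∈ A

open Term in
/-- The transition relation of the structural operational semantics. -/
inductive Step {α : Type u} : Term α → Label α → Term α → Prop where
  | pre (a : α) (P : Term α) : Step (pre a P) (.ev a) P
  | SKIP : Step SKIP .tick STOP
  | intL (P Q : Term α) : Step (intChoice P Q) .tau P
  | intR (P Q : Term α) : Step (intChoice P Q) .tau Q
  | extTauL {P P' Q : Term α} : Step P .tau P' → Step (extChoice P Q) .tau (extChoice P' Q)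
  | extTauR {P Q Q' : Term α} : Step Q .tau Q' → Step (extChoice P Q) .tau (extChoice P Q')
  | extL {P P' Q : Term α} {l : Label α} : l ≠ .tau → Step P l P' → Step (extChoice P Q) l P'
  | extR {P Q Q' : Term α} {l : Label α} : l ≠ .tau → Step Q l Q' → Step (extChoice P Q) l Q'
  | parL {A : Set α} {P P' Q : Term α} {l : Label α} :
      l ≠ .tick → ¬ l.In A → Step P l P' → Step (par A P Q) l (par A P' Q)
  | parR {A : Set α} {P Q Q' : Term α} {l : Label α} :
      l ≠ .tick → ¬ l.In A → Step Q l Q' → Step (par A P Q) l (par A P Q')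
  | parSync {A : Set α} {P P' Q Q' : Term α} {l : Label α} :
      (l = .tick ∨ l.In A) → Step P l P' → Step Q l Q' → Step (par A P Q) l (par A P' Q')
  | seqTick {P P' Q : Term α} : Step P .tick P' → Step (seq P Q) .tau Q
  | seqStep {P P' Q : Term α} {l : Label α} :
      l ≠ .tick → Step P l P' → Step (seq P Q) l (seq P' Q)
  | hideIn {A : Set α} {P P' : Term α} {a : α} :
      a ∈ A → Step P (.ev a) P' → Step (hide P A) .tau (hide P' A)
  | hideOut {A : Set α} {P P' : Term α} {l : Label α} :
      ¬ l.In A → Step P l P' → Step (hide P A) l (hide P' A)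
  | renameTau {R : α → α → Prop} {P P' : Term α} :
      Step P .tau P' → Step (rename P R) .tau (rename P' R)
  | renameTick {R : α → α → Prop} {P P' : Term α} :
      Step P .tick P' → Step (rename P R) .tick (rename P' R)
  | renameEv {R : α → α → Prop} {P P' : Term α} {a b : α} :
      R a b → Step P (.ev a) P' → Step (rename P R) (.ev b) (rename P' R)
  | mu (X : ℕ) (P : Term α) : Step (mu X P) .tau (subst X (mu X P) P)
  | DIV : Step DIV .tau DIV

/-- `Q` is a state of the (reachable) labelled transition system of `P`. -/
def Reachable {α : Type u} (P Q : Term α) : Prop :=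
  Relation.ReflTransGen (fun S S' => ∃ l, Step S l S') P Q

/-- There is an infinite path of silent transitions from `P`. -/
def Diverges {α : Type u} (P : Term α) : Prop :=
  ∃ f : ℕ → Term α, f 0 = P ∧ ∀ n, Step (f n) .tau (f (n + 1))

/-- A path all of whose labels lie in `L ∪ {τ}`. -/
def PathIn {α : Type u} (L : Set α) (P Q : Term α) : Prop :=
  Relation.ReflTransGen (fun S S' => ∃ l : Label α, (l = .tau ∨ l.In L) ∧ Step S l S') P Q

/-- `s` and `t` lie in the same strongly connected component of the graph in which only the
transitions labelled in `L ∪ {τ}` are kept. -/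
def SameSCC {α : Type u} (L : Set α) (s t : Term α) : Prop := PathIn L s t ∧ PathIn L t s

/-! ### Denotational semantics -/

/-- Finite traces: `(s, false)` is the trace `s ∈ Σ*`, and `(s, true)` is `s ⌢ ⟨✓⟩`.
These are exactly the finite sequences in which `✓` may occur only at the end. -/
abbrev Trace (α : Type u) : Type u := List α × Bool

/-- A pair `(T, D)` of a set of traces and a set of divergences. -/
structure TD (α : Type u) : Type u where
  tr : Set (Trace α)
  dv : Set (Trace α)

/-- The axioms that single out the elements of the model among the pairs `(T, D)`. -/
structure TD.IsModel {α : Type u} (x : TD α) : Prop where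
  dv_subset : x.dv ⊆ x.tr
  dv_of_tick : ∀ s, (s, true) ∈ x.dv → (s, false) ∈ x.dv
  nonempty : x.tr.Nonempty
  prefix_tick : ∀ s, (s, true) ∈ x.tr → (s, false) ∈ x.tr
  prefix_closed : ∀ s t, (s ++ t, false) ∈ x.tr → (s, false) ∈ x.tr
  postfix_closed : ∀ s t b, (s, false) ∈ x.dv → (s ++ t, b) ∈ x.dv

/-- The order of the model is reverse inclusion in both components. -/
def TD.Le {α : Type u} (x y : TD α) : Prop := y.tr ⊆ x.tr ∧ y.dv ⊆ x.dv

/-- The least fixed point of a monotone self-map `f` of the model: the greatest lower bound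
(which is the componentwise union) of all elements `x` of the model with `f x ⊑ x`. -/
def TD.fix {α : Type u} (f : TD α → TD α) : TD α where
  tr := {t | ∃ x : TD α, x.IsModel ∧ (f x).Le x ∧ t ∈ x.tr}
  dv := {t | ∃ x : TD α, x.IsModel ∧ (f x).Le x ∧ t ∈ x.dv}

/-- `Inter A s t u`: the sequence `u` is an interleaving of `s` and `t`, synchronised on `A`. -/
inductive Inter {α : Type u} (A : Set α) : List α → List α → List α → Prop where
  | nil : Inter A [] [] []
  | left {b : α} {s t w : List α} : b ∉ A → Inter A s t w → Inter A (b :: s) t (b :: w)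
  | right {b : α} {s t w : List α} : b ∉ A → Inter A s t w → Inter A s (b :: t) (b :: w)
  | sync {a : α} {s t w : List α} : a ∈ A → Inter A s t w → Inter A (a :: s) (a :: t) (a :: w)

/-- The prefix of length `n` of an infinite sequence. -/
def pref {α : Type u} (w : ℕ → α) (n : ℕ) : List α := (List.range n).map w

open Classical in
/-- `s ↾ (Σ ∖ A)`. -/
noncomputable def erase {α : Type u} (A : Set α) (s : List α) : List α :=
  s.filter (fun a => decide (a ∉ A))

namespace TD

variable {α : Type u}

def STOP : TD α := ⟨{([], false)}, ∅⟩

def SKIP : TD α := ⟨{([], false), ([], true)}, ∅⟩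

def DIV : TD α := ⟨Set.univ, Set.univ⟩

def pre (a : α) (x : TD α) : TD α where
  tr := {([], false)} ∪ {p | ∃ s b, (s, b) ∈ x.tr ∧ p = (a :: s, b)}
  dv := {p | ∃ s b, (s, b) ∈ x.dv ∧ p = (a :: s, b)}

def choice (x y : TD α) : TD α := ⟨x.tr ∪ y.tr, x.dv ∪ y.dv⟩

def seqDv (x y : TD α) : Set (Trace α) :=
  x.dv ∪ {p | ∃ t s b, (t, true) ∈ x.tr ∧ (s, b) ∈ y.dv ∧ p = (t ++ s, b)}

def seq (x y : TD α) : TD α where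
  tr := {p | p ∈ x.tr ∧ p.2 = false} ∪
    {p | ∃ t s b, (t, true) ∈ x.tr ∧ (s, b) ∈ y.tr ∧ p = (t ++ s, b)} ∪ seqDv x y
  dv := seqDv x y

/-- Divergence of a hidden process: either it diverged before, or it performs an infinite
sequence of events that from some point `N` on are all hidden. -/
def hideDv (A : Set α) (x : TD α) : Set (Trace α) :=
  {p | ∃ t r b, (t, false) ∈ x.dv ∧ p = (erase A t ++ r, b)} ∪
  {p | ∃ (w : ℕ → α) (N : ℕ) (r : List α) (b : Bool),
    (∀ n, (pref w n, false) ∈ x.tr) ∧ (∀ n, N ≤ n → w n ∈ A) ∧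
      p = (erase A (pref w N) ++ r, b)}

def hide (A : Set α) (x : TD α) : TD α where
  tr := {p | ∃ t b, (t, b) ∈ x.tr ∧ p = (erase A t, b)} ∪ hideDv A x
  dv := hideDv A x

def renameDv (R : α → α → Prop) (x : TD α) : Set (Trace α) :=
  {p | ∃ s t r b, (s, false) ∈ x.dv ∧ List.Forall₂ R s t ∧ p = (t ++ r, b)}

def rename (R : α → α → Prop) (x : TD α) : TD α where
  tr := {p | ∃ s t b, (s, b) ∈ x.tr ∧ List.Forall₂ R s t ∧ p = (t, b)} ∪ renameDv R x
  dv := renameDv R x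

def parDv (A : Set α) (x y : TD α) : Set (Trace α) :=
  {p | ∃ s t w r b, (s, false) ∈ x.tr ∧ (t, false) ∈ y.tr ∧ Inter A s t w ∧
    ((s, false) ∈ x.dv ∨ (t, false) ∈ y.dv) ∧ p = (w ++ r, b)}

/-- Parallel composition; `✓` is always synchronised. -/
def par (A : Set α) (x y : TD α) : TD α where
  tr := {p | ∃ s t w b, (s, b) ∈ x.tr ∧ (t, b) ∈ y.tr ∧ Inter A s t w ∧ p = (w, b)} ∪
    parDv A x y
  dv := parDv A x y

end TD

/-- The denotation of a term, given the denotations of its free variables. The first component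
of the result is the set of traces including the divergences. -/
noncomputable def sem {α : Type u} : Term α → (ℕ → TD α) → TD α
  | .STOP, _ => TD.STOP
  | .SKIP, _ => TD.SKIP
  | .DIV, _ => TD.DIV
  | .var X, ρ => ρ X
  | .pre a P, ρ => TD.pre a (sem P ρ)
  | .intChoice P Q, ρ => TD.choice (sem P ρ) (sem Q ρ)
  | .extChoice P Q, ρ => TD.choice (sem P ρ) (sem Q ρ)
  | .par A P Q, ρ => TD.par A (sem P ρ) (sem Q ρ)
  | .seq P Q, ρ => TD.seq (sem P ρ) (sem Q ρ)
  | .hide P A, ρ => TD.hide A (sem P ρ)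
  | .rename P R, ρ => TD.rename R (sem P ρ)
  | .mu X P, ρ => TD.fix (fun x => sem P (Function.update ρ X x))

/-- The denotation of a process (for a closed term the environment is irrelevant). -/
noncomputable def denot {α : Type u} (P : Term α) : TD α := sem P (fun _ => TD.DIV)

/-- A process is livelock-free if its set of divergences is empty. -/
def LivelockFree {α : Type u} (P : Term α) : Prop := (denot P).dv = ∅

/-- The infinite traces: all finite prefixes are traces of the process. -/
def infTraces {α : Type u} (P : Term α) : Set (ℕ → α) :=
  {w | ∀ n, (pref w n, false) ∈ (denot P).tr}

/-- Every event of `F` occurs infinitely often in `w`. -/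
def FairIn {α : Type u} (w : ℕ → α) (F : Set α) : Prop := ∀ a ∈ F, {n | w n = a}.Infinite

/-- Every event of `C` occurs at most finitely often in `w`. -/
def CofairIn {α : Type u} (w : ℕ → α) (C : Set α) : Prop := ∀ a ∈ C, {n | w n = a}.Finite

/-! ### Structurally finite-state processes and their static analysis -/

/-- Sequential terms. -/
inductive Sequential {α : Type u} : Term α → Prop where
  | STOP : Sequential .STOP
  | SKIP : Sequential .SKIP
  | var (X : ℕ) : Sequential (.var X)
  | pre {a : α} {P : Term α} : Sequential P → Sequential (.pre a P)
  | intChoice {P Q : Term α} : Sequential P → Sequential Q → Sequential (.intChoice P Q)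
  | extChoice {P Q : Term α} : Sequential P → Sequential Q → Sequential (.extChoice P Q)
  | mu {X : ℕ} {P : Term α} : Sequential P → Sequential (.mu X P)
  | seq {P Q : Term α} : Sequential P → P.Closed → Sequential Q → Sequential (.seq P Q)
  | hide {P : Term α} {A : Set α} : Sequential P → P.Closed → Sequential (.hide P A)
  | rename {P : Term α} {R : α → α → Prop} :
      Sequential P → P.Closed → Sequential (.rename P R)

/-- Structurally finite-state processes. -/
inductive SFS {α : Type u} : Term α → Prop where
  | base {P : Term α} : Sequential P → P.Closed → SFS P
  | pre {a : α} {P : Term α} : SFS P → SFS (.pre a P)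
  | intChoice {P Q : Term α} : SFS P → SFS Q → SFS (.intChoice P Q)
  | extChoice {P Q : Term α} : SFS P → SFS Q → SFS (.extChoice P Q)
  | par {A : Set α} {P Q : Term α} : SFS P → SFS Q → SFS (.par A P Q)
  | seq {P Q : Term α} : SFS P → SFS Q → SFS (.seq P Q)
  | hide {P : Term α} {A : Set α} : SFS P → SFS (.hide P A)
  | rename {P : Term α} {R : α → α → Prop} : SFS P → SFS (.rename P R)

/-- The fair/co-fair pairs of a sequential process, computed from its transition system: the pair
`(L, Σ ∖ L)` with `L ≠ ∅` is included iff, after deletion of the transitions labelled outside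
`L ∪ {τ}`, some strongly connected component comprises a transition for every event of `L`. -/
def phiSeq {α : Type u} (P : Term α) : Set (Set α × Set α) :=
  {p | ∃ L : Set α, L.Nonempty ∧ p = (L, Lᶜ) ∧
    ∃ s, Reachable P s ∧ ∀ a ∈ L, ∃ src dst,
      Step src (.ev a) dst ∧ SameSCC L s src ∧ SameSCC L s dst}

open Classical in
/-- The livelock flag of a sequential process, computed from its transition system: whether the
process can eventually diverge. -/
noncomputable def deltaSeq {α : Type u} (P : Term α) : Bool :=
  decide (∃ Q, Reachable P Q ∧ Diverges Q)

open Classical in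
/-- `seqOr P x y` is `x` if `P` is a sequential process, and `y` otherwise. -/
noncomputable def seqOr {α : Type u} {β : Type*} (P : Term α) (x y : β) : β :=
  if Sequential P ∧ P.Closed then x else y

def phiPar {α : Type u} (A : Set α) (Φ₁ Φ₂ : Set (Set α × Set α)) : Set (Set α × Set α) :=
  {p | p.1 ∩ p.2 = ∅ ∧ ∃ p₁ ∈ Φ₁, ∃ p₂ ∈ Φ₂, p.1 = p₁.1 ∪ p₂.1 ∧
    p.2 = (p₁.2 ∩ A) ∪ (p₂.2 ∩ A) ∪ ((p₁.2 \ A) ∩ (p₂.2 \ A))} ∪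
  {p | p ∈ Φ₁ ∧ p.1 ∩ A = ∅} ∪
  {p | p ∈ Φ₂ ∧ p.1 ∩ A = ∅}

def phiHide {α : Type u} (A : Set α) (Φ : Set (Set α × Set α)) : Set (Set α × Set α) :=
  {p | ∃ q ∈ Φ, p = (q.1 \ A, q.2 ∪ A)}

def phiRename {α : Type u} (R : α → α → Prop) (Φ : Set (Set α × Set α)) :
    Set (Set α × Set α) :=
  {p | ∃ q ∈ Φ, q.1 ⊆ {a | ∃ b ∈ p.1, R a b} ∧ p.1 ⊆ {b | ∃ a ∈ q.1, R a b} ∧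
    p.2 = {b | {a | R a b} ⊆ q.2}}

/-- The collection of fair/co-fair pairs. The fallback values for a variable, `DIV` and a
non-sequential recursion are immaterial: such terms are not structurally finite-state. -/
noncomputable def Phi {α : Type u} : Term α → Set (Set α × Set α)
  | .STOP => phiSeq .STOP
  | .SKIP => phiSeq .SKIP
  | .DIV => ∅
  | .var _ => ∅
  | .mu X P => seqOr (.mu X P) (phiSeq (.mu X P)) ∅
  | .pre a P => seqOr (.pre a P) (phiSeq (.pre a P)) (Phi P)
  | .intChoice P Q =>
      seqOr (.intChoice P Q) (phiSeq (.intChoice P Q)) (Phi P ∪ Phi Q)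
  | .extChoice P Q =>
      seqOr (.extChoice P Q) (phiSeq (.extChoice P Q)) (Phi P ∪ Phi Q)
  | .seq P Q => seqOr (.seq P Q) (phiSeq (.seq P Q)) (Phi P ∪ Phi Q)
  | .par A P Q => phiPar A (Phi P) (Phi Q)
  | .hide P A => seqOr (.hide P A) (phiSeq (.hide P A)) (phiHide A (Phi P))
  | .rename P R => seqOr (.rename P R) (phiSeq (.rename P R)) (phiRename R (Phi P))

open Classical in
/-- The livelock flag. The fallback values are again immaterial. -/
noncomputable def delta {α : Type u} : Term α → Bool
  | .STOP => deltaSeq (.STOP : Term α)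
  | .SKIP => deltaSeq (.SKIP : Term α)
  | .DIV => true
  | .var _ => true
  | .mu X P => seqOr (.mu X P) (deltaSeq (.mu X P)) true
  | .pre a P => seqOr (.pre a P) (deltaSeq (.pre a P)) (delta P)
  | .intChoice P Q =>
      seqOr (.intChoice P Q) (deltaSeq (.intChoice P Q)) (delta P || delta Q)
  | .extChoice P Q =>
      seqOr (.extChoice P Q) (deltaSeq (.extChoice P Q)) (delta P || delta Q)
  | .seq P Q => seqOr (.seq P Q) (deltaSeq (.seq P Q)) (delta P || delta Q)
  | .par _ P Q => delta P || delta Q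
  | .hide P A => seqOr (.hide P A) (deltaSeq (.hide P A))
      (if delta P = false ∧ ∀ p ∈ Phi P, (p.1 \ A).Nonempty then false else true)
  | .rename P R => seqOr (.rename P R) (deltaSeq (.rename P R)) (delta P)

end CSP

namespace CSP

universe u

variable {α : Type u}

namespace Term

/-! The two claims are proved together, as `Sound`, by induction on the structure of the process.
Freedom from divergence is needed to read infinite traces off the components, and fairness is needed
to exclude new divergence under hiding.

For a sequential process the flag and the pairs come from the transition system, so the denotation
must be tied to transitions. One direction suffices: every nonempty trace and every divergence
starts with a transition (`IsSeqProc.expands`). For recursion this is the half "contained in its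
unfolding" of the fixed-point law (`TD.fix_sub`). Finite branching carries it over to infinite
traces (`infTraces_step`). If no reachable state diverges, silent steps are well-founded, so there
are no divergences and every infinite trace is performed by a run.

The states entered by visible transitions all lie in the finite set `post`, so a run returns to one
of them infinitely often. If `L` is the set of events occurring infinitely often, the run eventually
uses only labels in `L ∪ {τ}`. The cycles through the recurring state then lie in one component that
meets every event of `L` (`IsSeqProc.exists_phiSeq`).

For the operators the argument uses only trace sets. Each prefix of an infinite trace comes from
finite traces of the components; Koenig's lemma or a pigeonhole argument turns these into infinite
traces of the components, and what remains is counting infinite and finite sets of positions. -/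

theorem closed_seq {P Q : Term α} : (seq P Q).Closed ↔ P.Closed ∧ Q.Closed := by
  simp [Closed, fv]

theorem closed_intChoice {P Q : Term α} : (intChoice P Q).Closed ↔ P.Closed ∧ Q.Closed := by
  simp [Closed, fv]

theorem closed_extChoice {P Q : Term α} : (extChoice P Q).Closed ↔ P.Closed ∧ Q.Closed := by
  simp [Closed, fv]

/-! ### Free variables and substitution -/

theorem subst_of_notMem_fv {X : ℕ} {Q : Term α} :
    ∀ {P : Term α}, X ∉ fv P → subst X Q P = P
  | STOP, _ => rfl
  | SKIP, _ => rfl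
  | DIV, _ => rfl
  | var Y, h => by
      have : Y ≠ X := fun e => h (by simp [fv, e])
      simp [subst, this]
  | pre a P, h => by simp only [subst, subst_of_notMem_fv (P := P) h]
  | intChoice P P', h => by
      simp only [fv, Set.mem_union, not_or] at h
      simp only [subst, subst_of_notMem_fv h.1, subst_of_notMem_fv h.2]
  | extChoice P P', h => by
      simp only [fv, Set.mem_union, not_or] at h
      simp only [subst, subst_of_notMem_fv h.1, subst_of_notMem_fv h.2]
  | par A P P', h => by
      simp only [fv, Set.mem_union, not_or] at h
      simp only [subst, subst_of_notMem_fv h.1, subst_of_notMem_fv h.2]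
  | seq P P', h => by
      simp only [fv, Set.mem_union, not_or] at h
      simp only [subst, subst_of_notMem_fv h.1, subst_of_notMem_fv h.2]
  | hide P A, h => by simp only [subst, subst_of_notMem_fv (P := P) h]
  | rename P R, h => by simp only [subst, subst_of_notMem_fv (P := P) h]
  | mu Y P, h => by
      by_cases e : Y = X
      · simp [subst, e]
      · have : X ∉ fv P := fun hX => h ⟨hX, fun h' => e h'.symm⟩
        simp only [subst, subst_of_notMem_fv this, ite_self]

theorem Closed.subst_eq {P : Term α} (h : P.Closed) (X : ℕ) (Q : Term α) :
    subst X Q P = P :=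
  subst_of_notMem_fv (by rw [show fv P = ∅ from h]; exact Set.notMem_empty X)

theorem fv_subst_subset {X : ℕ} {Q : Term α} (hQ : Q.Closed) (P : Term α) :
    fv (subst X Q P) ⊆ fv P \ {X} := by
  have hQ' : fv Q = ∅ := hQ
  induction P with
  | var Y =>
    by_cases e : Y = X
    · simp [subst, e, hQ']
    · simp [subst, e, fv]
  | mu Y P ih =>
    by_cases e : Y = X
    · subst e; simp [subst, fv]
    · simp only [subst, e, if_false, fv]
      intro Z hZ
      have := ih hZ.1
      exact ⟨⟨this.1, hZ.2⟩, this.2⟩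
  | _ => simp only [subst, fv]; grind

/-- Simultaneous substitution; it is capture-avoiding whenever the substituted terms are closed
or the bound variables themselves. -/
def close : Term α → (ℕ → Term α) → Term α
  | STOP, _ => STOP
  | SKIP, _ => SKIP
  | DIV, _ => DIV
  | var X, σ => σ X
  | pre a P, σ => pre a (close P σ)
  | intChoice P Q, σ => intChoice (close P σ) (close Q σ)
  | extChoice P Q, σ => extChoice (close P σ) (close Q σ)
  | par A P Q, σ => par A (close P σ) (close Q σ)
  | seq P Q, σ => seq (close P σ) (close Q σ)
  | hide P A, σ => hide (close P σ) A
  | rename P R, σ => rename (close P σ) R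
  | mu X P, σ => mu X (close P (Function.update σ X (var X)))

theorem close_congr (P : Term α) : ∀ {σ τ : ℕ → Term α}, (∀ X ∈ fv P, σ X = τ X) →
    close P σ = close P τ := by
  induction P with
  | STOP | SKIP | DIV => intros; rfl
  | var X => intro σ τ h; exact h X rfl
  | pre _ _ ih | hide _ _ ih | rename _ _ ih => intro σ τ h; simp only [close, ih h]
  | intChoice P Q ihP ihQ | extChoice P Q ihP ihQ | par _ P Q ihP ihQ | seq P Q ihP ihQ =>
    intro σ τ h
    simp only [close, ihP fun X hX => h X (Or.inl hX), ihQ fun X hX => h X (Or.inr hX)]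
  | mu X P ih =>
    intro σ τ h
    simp only [close]
    rw [ih]
    intro Y hY
    by_cases e : Y = X
    · subst e; simp
    · simpa [e] using h Y ⟨hY, e⟩

theorem close_var (P : Term α) : close P var = P := by
  induction P with
  | mu X P ih => simp only [close, Function.update_eq_self, ih]
  | _ => simp_all [close]

theorem Closed.close_eq {P : Term α} (h : P.Closed) (σ : ℕ → Term α) : close P σ = P := by
  have hP : fv P = ∅ := h
  rw [close_congr P (τ := var), close_var]
  simp [hP]

/-- A substitution can be absorbed into the valuation; this turns the unfolding of a recursion into
the update used in `post`. -/
theorem close_subst {X : ℕ} {Q : Term α} (hQ : Q.Closed) (P : Term α) :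
    ∀ σ : ℕ → Term α, close (subst X Q P) σ = close P (Function.update σ X Q) := by
  induction P with
  | var Y =>
    intro σ
    by_cases e : Y = X
    · subst e; simp [subst, close, hQ.close_eq]
    · simp [subst, close, e]
  | mu Y P ih =>
    intro σ
    by_cases e : Y = X
    · subst e; simp [subst, close]
    · simp only [subst, e, if_false, close, ih]
      rw [Function.update_comm e]
  | _ => simp_all [subst, close]

/-! ### The finite set of targets of visible transitions -/

/-- A finite set which contains every state that the closed instance of a sequential term can
enter by a visible transition. -/
def post : Term α → (ℕ → Term α) → Set (Term α)
  | pre _ P, σ => insert (close P σ) (post P σ)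
  | intChoice P Q, σ => post P σ ∪ post Q σ
  | extChoice P Q, σ => post P σ ∪ post Q σ
  | seq P Q, σ => (fun P' => seq P' (close Q σ)) '' post P σ ∪ post Q σ
  | hide P A, σ => (fun P' => hide P' A) '' post P σ
  | rename P R, σ => (fun P' => rename P' R) '' post P σ
  | mu X P, σ => post P (Function.update σ X (close (mu X P) σ))
  -- A variable contributes nothing: the process put in its place has targets of its own, and for a
  -- recursion these are the targets already collected from the body.
  | _, _ => ∅

theorem post_finite (P : Term α) : ∀ σ : ℕ → Term α, (post P σ).Finite := by
  induction P with
  | pre a P ih => exact fun σ => (ih σ).insert _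
  | intChoice P Q ihP ihQ | extChoice P Q ihP ihQ => exact fun σ => (ihP σ).union (ihQ σ)
  | seq P Q ihP ihQ => exact fun σ => ((ihP σ).image _).union (ihQ σ)
  | hide P A ih | rename P R ih => exact fun σ => (ih σ).image _
  | mu X P ih => exact fun σ => ih _
  | _ => exact fun _ => Set.finite_empty

theorem post_congr (P : Term α) : ∀ {σ τ : ℕ → Term α}, (∀ X ∈ fv P, σ X = τ X) →
    post P σ = post P τ := by
  induction P with
  | STOP | SKIP | DIV | var | par => intros; rfl
  | pre _ P ih => intro σ τ h; simp only [post, ih h, close_congr P h]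
  | hide _ _ ih | rename _ _ ih => intro σ τ h; simp only [post, ih h]
  | intChoice P Q ihP ihQ | extChoice P Q ihP ihQ =>
    intro σ τ h
    simp only [post, ihP fun X hX => h X (Or.inl hX), ihQ fun X hX => h X (Or.inr hX)]
  | seq P Q ihP ihQ =>
    intro σ τ h
    simp only [post, ihP fun X hX => h X (Or.inl hX), ihQ fun X hX => h X (Or.inr hX),
      close_congr Q fun X hX => h X (Or.inr hX)]
  | mu X P ih =>
    intro σ τ h
    simp only [post]
    rw [close_congr (mu X P) h]
    refine ih fun Y hY => ?_
    by_cases e : Y = X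
    · subst e; simp
    · simpa [e] using h Y ⟨hY, e⟩

theorem Closed.post_eq {P : Term α} (h : P.Closed) (σ τ : ℕ → Term α) :
    post P σ = post P τ :=
  post_congr P (by rw [show fv P = ∅ from h]; simp)

/-- A visible step is made either by the skeleton of `P` or by an inserted copy of `Q`.
Sequentiality matters here: the left operand of `;` and the operands of hiding and renaming are
closed, so no copy of `Q` sits inside such a context. Hence `post Q σ` appears bare, and contexts
cannot pile up as a recursion unfolds. -/
theorem post_subst_subset {X : ℕ} {Q P : Term α} (hQ : Q.Closed) (hP : Sequential P) :
    ∀ σ : ℕ → Term α, post (subst X Q P) σ ⊆ post P (Function.update σ X Q) ∪ post Q σ := by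
  induction hP with
  | STOP | SKIP => intro σ; simp [subst, post]
  | var Y =>
    intro σ
    by_cases e : Y = X <;> simp [subst, post, e]
  | @pre a P _ ih =>
    intro σ
    simp only [subst, post, close_subst hQ]
    have := ih σ
    grind
  | intChoice _ _ ihP ihQ | extChoice _ _ ihP ihQ =>
    intro σ
    simp only [subst, post]
    have := ihP σ
    have := ihQ σ
    grind
  | @seq P R _ hc _ _ ihR =>
    intro σ
    simp only [subst, post, close_subst hQ, hc.subst_eq]
    rw [hc.post_eq σ (Function.update σ X Q)]
    have := ihR σ
    grind
  | hide _ hc _ | rename _ hc _ =>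
    intro σ
    simp only [subst, post, hc.subst_eq]
    rw [hc.post_eq σ (Function.update σ X Q)]
    exact Set.subset_union_left
  | @mu Y P _ ih =>
    intro σ
    by_cases e : Y = X
    · subst e
      simp only [subst, if_true, post, close, Function.update_idem]
      exact Set.subset_union_left
    · have h := ih (Function.update σ Y (close (mu Y (subst X Q P)) σ))
      have e' : close (mu Y (subst X Q P)) σ = close (mu Y P) (Function.update σ X Q) := by
        have := close_subst hQ (X := X) (mu Y P) σ
        simpa only [subst, e, if_false] using this
      simp only [subst, e, if_false, post]
      rw [Function.update_comm e, hQ.post_eq _ σ] at h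
      rwa [← e']

end Term

open Term

/-! ### Transitions of sequential processes -/

theorem Sequential.subst {X : ℕ} {Q P : Term α} (hQ : Sequential Q) (hP : Sequential P) :
    Sequential (subst X Q P) := by
  induction hP with
  | STOP => exact .STOP
  | SKIP => exact .SKIP
  | var Y =>
    by_cases e : Y = X
    · simpa [Term.subst, e] using hQ
    · simpa [Term.subst, e] using Sequential.var Y
  | pre _ ih => exact .pre ih
  | intChoice _ _ ih ih' => exact .intChoice ih ih'
  | extChoice _ _ ih ih' => exact .extChoice ih ih'
  | mu h ih =>
    simp only [Term.subst]
    split_ifs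
    · exact .mu h
    · exact .mu ih
  | seq h hc _ _ ih => rw [Term.subst, hc.subst_eq]; exact .seq h hc ih
  | hide h hc _ => rw [Term.subst, hc.subst_eq]; exact .hide h hc
  | rename h hc _ => rw [Term.subst, hc.subst_eq]; exact .rename h hc

/-- `P` is a sequential process. -/
def IsSeqProc (P : Term α) : Prop := Sequential P ∧ P.Closed

theorem IsSeqProc.of_pre {a : α} {P : Term α} (h : IsSeqProc (.pre a P)) : IsSeqProc P := by
  obtain ⟨⟨⟩, hc⟩ := h
  exact ⟨‹_›, hc⟩

theorem IsSeqProc.of_intChoice {P Q : Term α} (h : IsSeqProc (.intChoice P Q)) :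
    IsSeqProc P ∧ IsSeqProc Q := by
  obtain ⟨⟨⟩, hc⟩ := h
  exact ⟨⟨‹_›, (closed_intChoice.1 hc).1⟩, ⟨‹_›, (closed_intChoice.1 hc).2⟩⟩

theorem IsSeqProc.of_extChoice {P Q : Term α} (h : IsSeqProc (.extChoice P Q)) :
    IsSeqProc P ∧ IsSeqProc Q := by
  obtain ⟨⟨⟩, hc⟩ := h
  exact ⟨⟨‹_›, (closed_extChoice.1 hc).1⟩, ⟨‹_›, (closed_extChoice.1 hc).2⟩⟩

theorem IsSeqProc.of_seq {P Q : Term α} (h : IsSeqProc (.seq P Q)) :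
    IsSeqProc P ∧ IsSeqProc Q := by
  obtain ⟨⟨⟩, hc⟩ := h
  exact ⟨⟨‹_›, ‹_›⟩, ⟨‹_›, (closed_seq.1 hc).2⟩⟩

theorem IsSeqProc.of_hide {P : Term α} {A : Set α} (h : IsSeqProc (.hide P A)) :
    IsSeqProc P := by
  obtain ⟨⟨⟩, hc⟩ := h
  exact ⟨‹_›, hc⟩

theorem IsSeqProc.of_rename {P : Term α} {R : α → α → Prop} (h : IsSeqProc (.rename P R)) :
    IsSeqProc P := by
  obtain ⟨⟨⟩, hc⟩ := h
  exact ⟨‹_›, hc⟩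

theorem IsSeqProc.step {P P' : Term α} {l : Label α} (h : Step P l P') :
    IsSeqProc P → IsSeqProc P' := by
  induction h with
  | pre a P => exact fun h => h.of_pre
  | SKIP => exact fun _ => ⟨.STOP, rfl⟩
  | intL => exact fun h => h.of_intChoice.1
  | intR => exact fun h => h.of_intChoice.2
  | extTauL _ ih =>
    intro h
    have h1 := ih h.of_extChoice.1
    have h2 := h.of_extChoice.2
    exact ⟨.extChoice h1.1 h2.1, closed_extChoice.2 ⟨h1.2, h2.2⟩⟩
  | extTauR _ ih =>
    intro h
    have h1 := h.of_extChoice.1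
    have h2 := ih h.of_extChoice.2
    exact ⟨.extChoice h1.1 h2.1, closed_extChoice.2 ⟨h1.2, h2.2⟩⟩
  | extL _ _ ih => exact fun h => ih h.of_extChoice.1
  | extR _ _ ih => exact fun h => ih h.of_extChoice.2
  | parL | parR | parSync => exact fun h => nomatch h.1
  | seqTick => exact fun h => h.of_seq.2
  | seqStep _ _ ih =>
    intro h
    have h1 := ih h.of_seq.1
    have h2 := h.of_seq.2
    exact ⟨.seq h1.1 h1.2 h2.1, closed_seq.2 ⟨h1.2, h2.2⟩⟩
  | hideIn _ _ ih | hideOut _ _ ih =>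
    intro h
    have h1 := ih h.of_hide
    exact ⟨.hide h1.1 h1.2, h1.2⟩
  | renameTau _ ih | renameTick _ ih | renameEv _ _ ih =>
    intro h
    have h1 := ih h.of_rename
    exact ⟨.rename h1.1 h1.2, h1.2⟩
  | mu X P =>
    rintro ⟨hs, hc⟩
    have hP : Sequential P := by cases hs; assumption
    refine ⟨hs.subst hP, ?_⟩
    have := fv_subst_subset (X := X) hc P
    rwa [show fv P \ {X} = ∅ from hc, Set.subset_empty_iff] at this
  | DIV => exact fun h => h

theorem IsSeqProc.reachable {P Q : Term α} (h : Reachable P Q) (hP : IsSeqProc P) :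
    IsSeqProc Q := by
  induction h with
  | refl => exact hP
  | tail _ h ih => exact ih.step h.choose_spec

/-- The invariant behind the finiteness argument: `post` never grows along a run, so every state
entered visibly, however late, belongs to the `post` of the initial process. -/
theorem post_step {P P' : Term α} {l : Label α} (h : Step P l P') :
    IsSeqProc P → post P' var ⊆ post P var ∧ ∀ a, l = .ev a → P' ∈ post P var := by
  induction h with
  | pre a P => exact fun _ => by simp [post, close_var]
  | SKIP => exact fun _ => by simp [post]
  | intL | intR => exact fun _ => by simp [post]
  | extTauL _ ih =>
    intro h
    have := (ih h.of_extChoice.1).1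
    simp only [post]
    grind
  | extTauR _ ih =>
    intro h
    have := (ih h.of_extChoice.2).1
    simp only [post]
    grind
  | extL _ _ ih =>
    intro h
    have := ih h.of_extChoice.1
    simp only [post]
    grind
  | extR _ _ ih =>
    intro h
    have := ih h.of_extChoice.2
    simp only [post]
    grind
  | parL | parR | parSync => exact fun h => nomatch h.1
  | seqTick => exact fun h => by simp [post]
  | seqStep _ _ ih =>
    intro h
    have := ih h.of_seq.1
    simp only [post, close_var]
    grind
  | hideIn _ _ ih | hideOut _ _ ih =>
    intro h
    have := ih h.of_hide
    simp only [post]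
    grind
  | renameTau _ ih | renameTick _ ih | renameEv _ _ ih =>
    intro h
    have := ih h.of_rename
    simp only [post]
    grind
  | mu X P =>
    rintro ⟨hs, hc⟩
    have hP : Sequential P := by cases hs; assumption
    have := post_subst_subset (X := X) hc hP var
    simp only [post, close_var] at this ⊢
    simpa using this
  | DIV => simp

theorem post_reachable {P Q : Term α} (h : Reachable P Q) (hP : IsSeqProc P) :
    post Q var ⊆ post P var := by
  induction h with
  | refl => exact subset_rfl
  | tail h h' ih => exact (post_step h'.choose_spec (hP.reachable h)).1.trans ih

/-- Targets are counted without their labels, so finite branching does not depend on the size of the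
alphabet, even for renaming. -/
theorem targets_finite (P : Term α) : {P' | ∃ l, Step P l P'}.Finite := by
  induction P with
  | STOP | var => exact Set.Finite.subset Set.finite_empty (by rintro _ ⟨l, ⟨⟩⟩)
  | SKIP => exact (Set.finite_singleton STOP).subset (by rintro _ ⟨l, ⟨⟩⟩; rfl)
  | DIV => exact (Set.finite_singleton DIV).subset (by rintro _ ⟨l, ⟨⟩⟩; rfl)
  | pre a P => exact (Set.finite_singleton P).subset (by rintro _ ⟨l, ⟨⟩⟩; rfl)
  | intChoice P Q =>
    exact (Set.toFinite {P, Q}).subset (by rintro _ ⟨l, ⟨⟩⟩ <;> simp)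
  | extChoice P Q ihP ihQ =>
    refine (((ihP.image fun P' => extChoice P' Q).union (ihQ.image fun Q' => extChoice P Q')).union
      (ihP.union ihQ)).subset ?_
    rintro _ ⟨l, h⟩
    cases h <;> simp <;> grind
  | par A P Q ihP ihQ =>
    refine (((ihP.image fun P' => par A P' Q).union (ihQ.image fun Q' => par A P Q')).union
      (ihP.image2 (fun P' Q' => par A P' Q') ihQ)).subset ?_
    rintro _ ⟨l, h⟩
    cases h <;> simp <;> grind
  | seq P Q ihP =>
    refine ((ihP.image fun P' => seq P' Q).union (Set.finite_singleton Q)).subset ?_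
    rintro _ ⟨l, h⟩
    cases h with
    | seqTick => exact Or.inr rfl
    | seqStep _ h => exact Or.inl ⟨_, ⟨_, h⟩, rfl⟩
  | hide P A ih =>
    refine (ih.image fun P' => hide P' A).subset ?_
    rintro _ ⟨l, h⟩
    cases h <;> exact ⟨_, ⟨_, ‹_›⟩, rfl⟩
  | rename P R ih =>
    refine (ih.image fun P' => rename P' R).subset ?_
    rintro _ ⟨l, h⟩
    cases h <;> exact ⟨_, ⟨_, ‹_›⟩, rfl⟩
  | mu X P =>
    exact (Set.finite_singleton (subst X (mu X P) P)).subset (by rintro _ ⟨l, ⟨⟩⟩; rfl)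

/-! ### Monotonicity and unfolding of the denotational semantics -/

/-- Componentwise inclusion. -/
def TD.Sub (x y : TD α) : Prop := x.tr ⊆ y.tr ∧ x.dv ⊆ y.dv

/-- The closure properties of the model which are used below. -/
structure TD.Coherent (x : TD α) : Prop where
  prefix_mem : ∀ s t b, (s ++ t, b) ∈ x.tr → (s, false) ∈ x.tr
  dv_subset : x.dv ⊆ x.tr

theorem TD.IsModel.coherent {x : TD α} (h : x.IsModel) : x.Coherent where
  prefix_mem s t b hs := by
    cases b
    · exact h.prefix_closed s t hs
    · exact h.prefix_closed s t (h.prefix_tick _ hs)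
  dv_subset := h.dv_subset

theorem TD.Sub.refl (x : TD α) : x.Sub x := ⟨subset_rfl, subset_rfl⟩

theorem TD.fix_sub_fix {f g : TD α → TD α} (h : ∀ x, (f x).Sub (g x)) :
    (TD.fix f).Sub (TD.fix g) :=
  ⟨fun _ ⟨x, hx, hf, ht⟩ => ⟨x, hx, ⟨hf.1.trans (h x).1, hf.2.trans (h x).2⟩, ht⟩,
    fun _ ⟨x, hx, hf, ht⟩ => ⟨x, hx, ⟨hf.1.trans (h x).1, hf.2.trans (h x).2⟩, ht⟩⟩

/-- Half of Knaster–Tarski. In terms of inclusion, `TD.fix f` is the union of the models `x`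
contained in `f x`, and by monotonicity each of these `f x` is contained in `f (TD.fix f)`. This
half does not require `f` to preserve the model. -/
theorem TD.fix_sub {f : TD α → TD α} (hf : ∀ x y : TD α, x.Sub y → (f x).Sub (f y)) :
    (TD.fix f).Sub (f (TD.fix f)) := by
  have key : ∀ x : TD α, x.IsModel → (f x).Le x → (f x).Sub (f (TD.fix f)) := fun x hx hfx =>
    hf _ _ ⟨fun _ ht => ⟨x, hx, hfx, ht⟩, fun _ ht => ⟨x, hx, hfx, ht⟩⟩
  exact ⟨fun _ ⟨x, hx, hfx, ht⟩ => (key x hx hfx).1 (hfx.1 ht),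
    fun _ ⟨x, hx, hfx, ht⟩ => (key x hx hfx).2 (hfx.2 ht)⟩

theorem TD.pre_sub {a : α} {x y : TD α} (h : x.Sub y) : (TD.pre a x).Sub (TD.pre a y) := by
  obtain ⟨h1, h2⟩ := h
  constructor
  · rintro _ (ht | ⟨s, b, ht, rfl⟩)
    · exact Or.inl ht
    · exact Or.inr ⟨s, b, h1 ht, rfl⟩
  · rintro _ ⟨s, b, ht, rfl⟩
    exact ⟨s, b, h2 ht, rfl⟩

theorem TD.choice_sub {x y x' y' : TD α} (h : x.Sub y) (h' : x'.Sub y') :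
    (TD.choice x x').Sub (TD.choice y y') :=
  ⟨Set.union_subset_union h.1 h'.1, Set.union_subset_union h.2 h'.2⟩

theorem TD.seq_sub {x y x' y' : TD α} (h : x.Sub y) (h' : x'.Sub y') :
    (TD.seq x x').Sub (TD.seq y y') := by
  have hd : TD.seqDv x x' ⊆ TD.seqDv y y' := by
    rintro _ (ht | ⟨t, s, b, h1, h2, rfl⟩)
    · exact Or.inl (h.2 ht)
    · exact Or.inr ⟨t, s, b, h.1 h1, h'.2 h2, rfl⟩
  refine ⟨?_, hd⟩
  rintro _ ((ht | ⟨t, s, b, h1, h2, rfl⟩) | ht)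
  · exact Or.inl (Or.inl ⟨h.1 ht.1, ht.2⟩)
  · exact Or.inl (Or.inr ⟨t, s, b, h.1 h1, h'.1 h2, rfl⟩)
  · exact Or.inr (hd ht)

theorem TD.hide_sub {A : Set α} {x y : TD α} (h : x.Sub y) :
    (TD.hide A x).Sub (TD.hide A y) := by
  have hd : TD.hideDv A x ⊆ TD.hideDv A y := by
    rintro _ (⟨t, r, b, h1, rfl⟩ | ⟨w, N, r, b, h1, h2, rfl⟩)
    · exact Or.inl ⟨t, r, b, h.2 h1, rfl⟩
    · exact Or.inr ⟨w, N, r, b, fun n => h.1 (h1 n), h2, rfl⟩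
  refine ⟨?_, hd⟩
  rintro _ (⟨t, b, ht, rfl⟩ | ht)
  · exact Or.inl ⟨t, b, h.1 ht, rfl⟩
  · exact Or.inr (hd ht)

theorem TD.rename_sub {R : α → α → Prop} {x y : TD α} (h : x.Sub y) :
    (TD.rename R x).Sub (TD.rename R y) := by
  have hd : TD.renameDv R x ⊆ TD.renameDv R y := by
    rintro _ ⟨s, t, r, b, h1, h2, rfl⟩
    exact ⟨s, t, r, b, h.2 h1, h2, rfl⟩
  refine ⟨?_, hd⟩
  rintro _ (⟨s, t, b, ht, h2, rfl⟩ | ht)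
  · exact Or.inl ⟨s, t, b, h.1 ht, h2, rfl⟩
  · exact Or.inr (hd ht)

theorem TD.par_sub {A : Set α} {x y x' y' : TD α} (h : x.Sub y) (h' : x'.Sub y') :
    (TD.par A x x').Sub (TD.par A y y') := by
  have hd : TD.parDv A x x' ⊆ TD.parDv A y y' := by
    rintro _ ⟨s, t, w, r, b, h1, h2, h3, h4, rfl⟩
    exact ⟨s, t, w, r, b, h.1 h1, h'.1 h2, h3, h4.imp (@h.2 _) (@h'.2 _), rfl⟩
  refine ⟨?_, hd⟩
  rintro _ (⟨s, t, w, b, h1, h2, h3, rfl⟩ | ht)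
  · exact Or.inl ⟨s, t, w, b, h.1 h1, h'.1 h2, h3, rfl⟩
  · exact Or.inr (hd ht)

theorem sem_mono (P : Term α) :
    ∀ {ρ ρ' : ℕ → TD α}, (∀ X, (ρ X).Sub (ρ' X)) → (sem P ρ).Sub (sem P ρ') := by
  induction P with
  | STOP | SKIP | DIV => intros; exact TD.Sub.refl _
  | var X => exact fun h => h X
  | pre a P ih => exact fun h => TD.pre_sub (ih h)
  | intChoice P Q ihP ihQ | extChoice P Q ihP ihQ => exact fun h => TD.choice_sub (ihP h) (ihQ h)
  | par A P Q ihP ihQ => exact fun h => TD.par_sub (ihP h) (ihQ h)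
  | seq P Q ihP ihQ => exact fun h => TD.seq_sub (ihP h) (ihQ h)
  | hide P A ih => exact fun h => TD.hide_sub (ih h)
  | rename P R ih => exact fun h => TD.rename_sub (ih h)
  | mu X P ih =>
    intro ρ ρ' h
    refine TD.fix_sub_fix fun x => ih fun Y => ?_
    by_cases e : Y = X
    · subst e; simpa using TD.Sub.refl x
    · simpa [e] using h Y

theorem sem_congr (P : Term α) :
    ∀ {ρ ρ' : ℕ → TD α}, (∀ X ∈ P.fv, ρ X = ρ' X) → sem P ρ = sem P ρ' := by
  induction P with
  | STOP | SKIP | DIV => intros; rfl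
  | var X => exact fun h => h X rfl
  | pre _ _ ih | hide _ _ ih | rename _ _ ih => intro ρ ρ' h; simp only [sem, ih h]
  | intChoice P Q ihP ihQ | extChoice P Q ihP ihQ | par _ P Q ihP ihQ | seq P Q ihP ihQ =>
    intro ρ ρ' h
    simp only [sem, ihP fun X hX => h X (Or.inl hX), ihQ fun X hX => h X (Or.inr hX)]
  | mu X P ih =>
    intro ρ ρ' h
    simp only [sem]
    congr 1
    funext x
    refine ih fun Y hY => ?_
    by_cases e : Y = X
    · subst e; simp
    · simpa [e] using h Y ⟨hY, e⟩

theorem sem_eq_denot {P : Term α} (h : P.Closed) (ρ : ℕ → TD α) : sem P ρ = denot P :=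
  sem_congr P (by rw [show P.fv = ∅ from h]; simp)

theorem sem_subst {X : ℕ} {Q : Term α} (hQ : Q.Closed) (P : Term α) :
    ∀ ρ : ℕ → TD α, sem (Term.subst X Q P) ρ = sem P (Function.update ρ X (denot Q)) := by
  induction P with
  | var Y =>
    intro ρ
    by_cases e : Y = X
    · subst e; simp [Term.subst, sem, sem_eq_denot hQ]
    · simp [Term.subst, sem, e]
  | mu Y P ih =>
    intro ρ
    by_cases e : Y = X
    · subst e; simp [Term.subst, sem]
    · simp only [Term.subst, e, if_false, sem, ih]
      congr 1
      funext x
      rw [Function.update_comm e]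
  | _ => simp_all [Term.subst, sem]

theorem denot_mu_sub {X : ℕ} {P : Term α} (h : (Term.mu X P).Closed) :
    (denot (.mu X P)).Sub (denot (Term.subst X (.mu X P) P)) := by
  conv_rhs => rw [denot, sem_subst h]
  refine TD.fix_sub fun x y hxy => sem_mono P fun Y => ?_
  by_cases e : Y = X
  · subst e; simpa using hxy
  · simpa [e] using TD.Sub.refl _

/-! ### Prefix closure -/

theorem Inter.split {A : Set α} {s t w : List α} (h : Inter A s t w) :
    ∀ w₁ w₂, w = w₁ ++ w₂ → ∃ s₁ s₂ t₁ t₂, s = s₁ ++ s₂ ∧ t = t₁ ++ t₂ ∧ Inter A s₁ t₁ w₁ := by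
  induction h with
  | nil =>
    intro w₁ w₂ e
    obtain ⟨rfl, rfl⟩ := List.append_eq_nil_iff.1 e.symm
    exact ⟨[], [], [], [], rfl, rfl, .nil⟩
  | @left b s t w hb h ih =>
    rintro (_ | ⟨c, w₁⟩) w₂ e
    · exact ⟨[], b :: s, [], t, rfl, rfl, .nil⟩
    · obtain ⟨rfl, rfl⟩ : b = c ∧ w = w₁ ++ w₂ := by simpa using e
      obtain ⟨s₁, s₂, t₁, t₂, rfl, rfl, h'⟩ := ih w₁ w₂ rfl
      exact ⟨b :: s₁, s₂, t₁, t₂, rfl, rfl, .left hb h'⟩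
  | @right b s t w hb h ih =>
    rintro (_ | ⟨c, w₁⟩) w₂ e
    · exact ⟨[], s, [], b :: t, rfl, rfl, .nil⟩
    · obtain ⟨rfl, rfl⟩ : b = c ∧ w = w₁ ++ w₂ := by simpa using e
      obtain ⟨s₁, s₂, t₁, t₂, rfl, rfl, h'⟩ := ih w₁ w₂ rfl
      exact ⟨s₁, s₂, b :: t₁, t₂, rfl, rfl, .right hb h'⟩
  | @sync b s t w hb h ih =>
    rintro (_ | ⟨c, w₁⟩) w₂ e
    · exact ⟨[], b :: s, [], b :: t, rfl, rfl, .nil⟩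
    · obtain ⟨rfl, rfl⟩ : b = c ∧ w = w₁ ++ w₂ := by simpa using e
      obtain ⟨s₁, s₂, t₁, t₂, rfl, rfl, h'⟩ := ih w₁ w₂ rfl
      exact ⟨b :: s₁, s₂, b :: t₁, t₂, rfl, rfl, .sync hb h'⟩

theorem erase_append (A : Set α) (s t : List α) : erase A (s ++ t) = erase A s ++ erase A t :=
  List.filter_append ..

theorem forall₂_split {R : α → α → Prop} {s t₁ t₂ : List α}
    (h : List.Forall₂ R s (t₁ ++ t₂)) :
    ∃ s₁ s₂, s = s₁ ++ s₂ ∧ List.Forall₂ R s₁ t₁ := by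
  induction t₁ generalizing s with
  | nil => exact ⟨[], s, rfl, .nil⟩
  | cons b t₁ ih =>
    obtain ⟨a, s', hab, h', rfl⟩ := List.forall₂_cons_right_iff.1 h
    obtain ⟨s₁, s₂, rfl, h''⟩ := ih h'
    exact ⟨a :: s₁, s₂, rfl, .cons hab h''⟩

/-- A prefix of `u ++ r` is a prefix of `u`, or extends `u`. -/
theorem append_cases {s t u r : List α} (h : s ++ t = u ++ r) :
    (∃ u', u = s ++ u') ∨ ∃ r', s = u ++ r' := by
  rcases List.append_eq_append_iff.1 h with ⟨a, h, _⟩ | ⟨a, h, _⟩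
  · exact Or.inl ⟨a, h⟩
  · exact Or.inr ⟨a, h⟩

theorem pref_prefix (w : ℕ → α) {m n : ℕ} (h : m ≤ n) : ∃ t, pref w n = pref w m ++ t := by
  obtain ⟨k, rfl⟩ := Nat.exists_eq_add_of_le h
  exact ⟨_, by rw [pref, List.range_add, List.map_append]; rfl⟩

theorem TD.Coherent.pref_mem {x : TD α} (hx : x.Coherent) {w : ℕ → α} {m n : ℕ} (h : m ≤ n)
    (hn : (pref w n, false) ∈ x.tr) : (pref w m, false) ∈ x.tr := by
  obtain ⟨t, ht⟩ := pref_prefix w h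
  exact hx.prefix_mem _ t false (ht ▸ hn)

theorem TD.Coherent.pre {a : α} {x : TD α} (hx : x.Coherent) : (TD.pre a x).Coherent where
  dv_subset := fun _ ⟨s, b, h, e⟩ => Or.inr ⟨s, b, hx.dv_subset h, e⟩
  prefix_mem := by
    rintro (_ | ⟨c, s⟩) t b (h | ⟨s', b', h, e⟩)
    · exact Or.inl rfl
    · exact Or.inl rfl
    · simp at h
    · simp only [List.cons_append, Prod.mk.injEq, List.cons.injEq] at e
      obtain ⟨⟨rfl, rfl⟩, rfl⟩ := e
      exact Or.inr ⟨s, false, hx.prefix_mem _ _ _ h, rfl⟩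

theorem TD.Coherent.choice {x y : TD α} (hx : x.Coherent) (hy : y.Coherent) :
    (TD.choice x y).Coherent where
  dv_subset := Set.union_subset_union hx.dv_subset hy.dv_subset
  prefix_mem := fun s t b h => h.imp (hx.prefix_mem s t b) (hy.prefix_mem s t b)

theorem TD.Coherent.seq {x y : TD α} (hx : x.Coherent) (hy : y.Coherent) :
    (TD.seq x y).Coherent where
  dv_subset := Set.subset_union_right
  prefix_mem := by
    have key : ∀ s t u r b, s ++ t = u ++ r → (u, true) ∈ x.tr → (r, b) ∈ y.tr →
        (s, false) ∈ (TD.seq x y).tr := by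
      intro s t u r b e hu hr
      rcases append_cases e with ⟨u', rfl⟩ | ⟨r', rfl⟩
      · exact Or.inl (Or.inl ⟨hx.prefix_mem _ _ _ hu, rfl⟩)
      · rw [List.append_assoc] at e
        obtain rfl := List.append_cancel_left e
        exact Or.inl (Or.inr ⟨u, r', false, hu, hy.prefix_mem _ _ _ hr, rfl⟩)
    rintro s t b ((h | ⟨u, r, b', hu, hr, e⟩) | (h | ⟨u, r, b', hu, hr, e⟩))
    · exact Or.inl (Or.inl ⟨hx.prefix_mem _ _ _ h.1, rfl⟩)
    · exact key s t u r b' (Prod.mk.inj e).1 hu hr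
    · exact Or.inl (Or.inl ⟨hx.prefix_mem _ _ _ (hx.dv_subset h), rfl⟩)
    · exact key s t u r b' (Prod.mk.inj e).1 hu (hy.dv_subset hr)

theorem TD.Coherent.hide {A : Set α} {x : TD α} (hx : x.Coherent) :
    (TD.hide A x).Coherent where
  dv_subset := Set.subset_union_right
  prefix_mem := by
    have key : ∀ s t u b, s ++ t = erase A u → (u, b) ∈ x.tr →
        (s, false) ∈ (TD.hide A x).tr := by
      intro s t u b e hu
      -- A prefix of a filtered list is the filter of a prefix.
      obtain ⟨u₁, u₂, rfl, rfl, -⟩ := List.filter_eq_append_iff.1 e.symm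
      exact Or.inl ⟨u₁, false, hx.prefix_mem _ _ _ hu, rfl⟩
    rintro s t b (⟨u, b', hu, e⟩ | (⟨u, r, b', hu, e⟩ | ⟨w, N, r, b', hw, hN, e⟩))
    · exact key s t u b' (Prod.mk.inj e).1 hu
    · rcases append_cases (Prod.mk.inj e).1 with ⟨u', e'⟩ | ⟨r', rfl⟩
      · exact key s u' u _ e'.symm (hx.dv_subset hu)
      · exact Or.inr (Or.inl ⟨u, r', false, hu, rfl⟩)
    · rcases append_cases (Prod.mk.inj e).1 with ⟨u', e'⟩ | ⟨r', rfl⟩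
      · exact key s u' _ _ e'.symm (hw N)
      · exact Or.inr (Or.inr ⟨w, N, r', false, hw, hN, rfl⟩)

theorem TD.Coherent.rename {R : α → α → Prop} {x : TD α} (hx : x.Coherent) :
    (TD.rename R x).Coherent where
  dv_subset := Set.subset_union_right
  prefix_mem := by
    have key : ∀ s t u b, List.Forall₂ R u (s ++ t) → (u, b) ∈ x.tr →
        (s, false) ∈ (TD.rename R x).tr := by
      intro s t u b h hu
      obtain ⟨u₁, u₂, rfl, h'⟩ := forall₂_split h
      exact Or.inl ⟨u₁, s, false, hx.prefix_mem _ _ _ hu, h', rfl⟩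
    rintro s t b (⟨u, v, b', hu, h, e⟩ | ⟨u, v, r, b', hu, h, e⟩)
    · obtain rfl := (Prod.mk.inj e).1
      exact key s t u b' h hu
    · rcases append_cases (Prod.mk.inj e).1 with ⟨u', rfl⟩ | ⟨r', rfl⟩
      · exact key s u' u _ h (hx.dv_subset hu)
      · exact Or.inr ⟨u, v, r', false, hu, h, rfl⟩

theorem TD.Coherent.par {A : Set α} {x y : TD α} (hx : x.Coherent) (hy : y.Coherent) :
    (TD.par A x y).Coherent where
  dv_subset := Set.subset_union_right
  prefix_mem := by
    have key : ∀ s t u v b, Inter A u v (s ++ t) → (u, b) ∈ x.tr → (v, b) ∈ y.tr →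
        (s, false) ∈ (TD.par A x y).tr := by
      intro s t u v b h hu hv
      obtain ⟨u₁, u₂, v₁, v₂, rfl, rfl, h'⟩ := h.split s t rfl
      exact Or.inl ⟨u₁, v₁, s, false, hx.prefix_mem _ _ _ hu, hy.prefix_mem _ _ _ hv, h', rfl⟩
    rintro s t b (⟨u, v, w, b', hu, hv, h, e⟩ | ⟨u, v, w, r, b', hu, hv, h, hd, e⟩)
    · obtain rfl := (Prod.mk.inj e).1
      exact key s t u v b' h hu hv
    · rcases append_cases (Prod.mk.inj e).1 with ⟨u', rfl⟩ | ⟨r', rfl⟩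
      · exact key s u' u v _ h hu hv
      · exact Or.inr ⟨u, v, w, r', false, hu, hv, h, hd, rfl⟩

/-- The fixed point is by definition a union of models, and coherence passes to unions; hence
nothing is asked of `f`. -/
theorem TD.coherent_fix (f : TD α → TD α) : (TD.fix f).Coherent where
  dv_subset := fun _ ⟨x, hx, hf, h⟩ => ⟨x, hx, hf, hx.dv_subset h⟩
  prefix_mem := fun s t b ⟨x, hx, hf, h⟩ => ⟨x, hx, hf, hx.coherent.prefix_mem s t b h⟩

theorem coherent_sem (P : Term α) {ρ : ℕ → TD α} (hρ : ∀ X, (ρ X).Coherent) :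
    (sem P ρ).Coherent := by
  induction P with
  | STOP => exact ⟨by simp +contextual [sem, TD.STOP], by simp [sem, TD.STOP]⟩
  | SKIP => exact ⟨by simp +contextual [sem, TD.SKIP], by simp [sem, TD.SKIP]⟩
  | DIV => exact ⟨by simp [sem, TD.DIV], by simp [sem, TD.DIV]⟩
  | var X => exact hρ X
  | pre a P ih => exact ih.pre
  | intChoice P Q ihP ihQ | extChoice P Q ihP ihQ => exact ihP.choice ihQ
  | par A P Q ihP ihQ => exact ihP.par ihQ
  | seq P Q ihP ihQ => exact ihP.seq ihQ
  | hide P A ih => exact ih.hide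
  | rename P R ih => exact ih.rename
  | mu X P => exact TD.coherent_fix _

theorem coherent_denot (P : Term α) : (denot P).Coherent :=
  coherent_sem P fun _ => ⟨by simp [TD.DIV], by simp [TD.DIV]⟩

/-! ### Justifying traces and divergences by transitions -/

/-- `p` is obtained by a silent or visible transition from `P` to `P'`, followed by an element
of `V P'`. -/
inductive Unfold (V : Term α → Set (Trace α)) (P : Term α) : Trace α → Prop where
  | tau {P' : Term α} {p : Trace α} : Step P .tau P' → p ∈ V P' → Unfold V P p
  | ev {P' : Term α} {a : α} {s : List α} {b : Bool} :
      Step P (.ev a) P' → (s, b) ∈ V P' → Unfold V P (a :: s, b)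

theorem Unfold.mono {V W : Term α → Set (Trace α)} (h : ∀ P, V P ⊆ W P) {P : Term α}
    {p : Trace α} (hp : Unfold V P p) : Unfold W P p := by
  cases hp with
  | tau hs hp => exact .tau hs (h _ hp)
  | ev hs hp => exact .ev hs (h _ hp)

/-- Nonempty traces and divergences of `P` are justified by transitions of `P`. -/
structure Expands (P : Term α) : Prop where
  tr : ∀ p ∈ (denot P).tr, p = ([], false) ∨ Unfold (fun Q => (denot Q).tr) P p ∨
    (p = ([], true) ∧ ∃ P', Step P .tick P')
  dv : ∀ p ∈ (denot P).dv, Unfold (fun Q => (denot Q).dv) P p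

theorem Unfold.of_dv {P : Term α} {p : Trace α} (h : Unfold (fun Q => (denot Q).dv) P p) :
    p = ([], false) ∨ Unfold (fun Q => (denot Q).tr) P p ∨
      (p = ([], true) ∧ ∃ P', Step P .tick P') :=
  Or.inr (Or.inl (h.mono fun Q => (coherent_denot Q).dv_subset))

theorem pref_succ (w : ℕ → α) (n : ℕ) : pref w (n + 1) = w 0 :: pref (fun i => w (i + 1)) n := by
  rw [pref, List.range_succ_eq_map, List.map_cons, List.map_map]
  rfl

theorem infTraces_step {P : Term α} (hP : Expands P) {w : ℕ → α} (hw : w ∈ infTraces P) :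
    (∃ P', Step P .tau P' ∧ w ∈ infTraces P') ∨
      ∃ P', Step P (.ev (w 0)) P' ∧ (fun i => w (i + 1)) ∈ infTraces P' := by
  by_contra! hcon
  have key : ∀ (v : ℕ → α) (P' : Term α), v ∉ infTraces P' →
      ∀ᶠ n in Filter.atTop, (pref v n, false) ∉ (denot P').tr := by
    intro v P' hv
    simp only [infTraces, Set.mem_ofPred_eq, not_forall] at hv
    obtain ⟨N, hN⟩ := hv
    exact Filter.eventually_atTop.2 ⟨N, fun n hn h => hN ((coherent_denot P').pref_mem hn h)⟩
  have hall : ∀ᶠ n in Filter.atTop, ∀ P' ∈ {P' | ∃ l, Step P l P'},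
      (Step P .tau P' → (pref w n, false) ∉ (denot P').tr) ∧
        (Step P (.ev (w 0)) P' → (pref (fun i => w (i + 1)) n, false) ∉ (denot P').tr) := by
    rw [Filter.eventually_all_finite (targets_finite P)]
    intro P' _
    refine Filter.Eventually.and ?_ ?_
    · by_cases h : Step P .tau P'
      · exact (key w P' (hcon.1 P' h)).mono fun _ h' _ => h'
      · exact Filter.Eventually.of_forall fun _ h' => absurd h' h
    · by_cases h : Step P (.ev (w 0)) P'
      · exact (key _ P' (hcon.2 P' h)).mono fun _ h' _ => h'
      · exact Filter.Eventually.of_forall fun _ h' => absurd h' h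
  obtain ⟨n, hn⟩ := hall.exists
  -- Length `n + 1` serves both cases: a visible step strips one event, and after a silent step the
  -- prefix is shortened to `n`.
  have hmem := hw (n + 1)
  rcases hP.tr _ hmem with h | h | h
  · simp [pref_succ] at h
  · generalize hp : (pref w (n + 1), false) = p at h
    cases h with
    | tau hs hp' =>
      subst hp
      exact (hn _ ⟨_, hs⟩).1 hs ((coherent_denot _).pref_mem n.le_succ hp')
    | ev hs hp' =>
      simp only [pref_succ, Prod.mk.injEq, List.cons.injEq] at hp
      obtain ⟨⟨rfl, rfl⟩, rfl⟩ := hp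
      exact (hn _ ⟨_, hs⟩).2 hs hp'
  · simp [pref_succ] at h

theorem erase_cons_of_mem {A : Set α} {a : α} (h : a ∈ A) (s : List α) :
    erase A (a :: s) = erase A s := by
  simp [erase, h]

theorem erase_cons_of_notMem {A : Set α} {a : α} (h : a ∉ A) (s : List α) :
    erase A (a :: s) = a :: erase A s := by
  simp [erase, h]

theorem Expands.pre (a : α) (P : Term α) : Expands (.pre a P) where
  tr := by
    rintro _ (h | ⟨s, b, h, rfl⟩)
    · exact Or.inl h
    · exact Or.inr (Or.inl (.ev (.pre a P) h))
  dv := by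
    rintro _ ⟨s, b, h, rfl⟩
    exact .ev (.pre a P) h

theorem Expands.intChoice (P Q : Term α) : Expands (.intChoice P Q) where
  tr := by
    rintro p (h | h)
    · exact Or.inr (Or.inl (.tau (.intL P Q) h))
    · exact Or.inr (Or.inl (.tau (.intR P Q) h))
  dv := by
    rintro p (h | h)
    · exact .tau (.intL P Q) h
    · exact .tau (.intR P Q) h

theorem Expands.extChoice {P Q : Term α} (hP : Expands P) (hQ : Expands Q) :
    Expands (.extChoice P Q) where
  tr := by
    rintro p (h | h)
    · rcases hP.tr p h with h | h | ⟨rfl, P', h⟩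
      · exact Or.inl h
      · cases h with
        | tau hs h' => exact Or.inr (Or.inl (.tau (.extTauL hs) (Or.inl h')))
        | ev hs h' => exact Or.inr (Or.inl (.ev (.extL (by simp) hs) h'))
      · exact Or.inr (Or.inr ⟨rfl, P', .extL (by simp) h⟩)
    · rcases hQ.tr p h with h | h | ⟨rfl, P', h⟩
      · exact Or.inl h
      · cases h with
        | tau hs h' => exact Or.inr (Or.inl (.tau (.extTauR hs) (Or.inr h')))
        | ev hs h' => exact Or.inr (Or.inl (.ev (.extR (by simp) hs) h'))
      · exact Or.inr (Or.inr ⟨rfl, P', .extR (by simp) h⟩)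
  dv := by
    rintro p (h | h)
    · cases hP.dv p h with
      | tau hs h' => exact .tau (.extTauL hs) (Or.inl h')
      | ev hs h' => exact .ev (.extL (by simp) hs) h'
    · cases hQ.dv p h with
      | tau hs h' => exact .tau (.extTauR hs) (Or.inr h')
      | ev hs h' => exact .ev (.extR (by simp) hs) h'

theorem Expands.seq {P Q : Term α} (hP : Expands P) : Expands (.seq P Q) := by
  have hdv : ∀ p ∈ (denot (.seq P Q)).dv, Unfold (fun Q => (denot Q).dv) (.seq P Q) p := by
    rintro _ (h | ⟨t, s, b, ht, hs, rfl⟩)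
    · cases hP.dv _ h with
      | tau hs h' => exact .tau (.seqStep (by simp) hs) (Or.inl h')
      | ev hs h' => exact .ev (.seqStep (by simp) hs) (Or.inl h')
    · rcases hP.tr _ ht with h | h | ⟨h, P', hst⟩
      · simp at h
      · cases h with
        | tau hst h' => exact .tau (.seqStep (by simp) hst) (Or.inr ⟨t, s, b, h', hs, rfl⟩)
        | ev hst h' => exact .ev (.seqStep (by simp) hst) (Or.inr ⟨_, s, b, h', hs, rfl⟩)
      · obtain rfl := (Prod.mk.inj h).1
        exact .tau (.seqTick hst) hs
  refine ⟨?_, hdv⟩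
  rintro _ ((⟨h, hb⟩ | ⟨t, s, b, ht, hs, rfl⟩) | h)
  · rcases hP.tr _ h with h | h | ⟨rfl, -⟩
    · exact Or.inl h
    · cases h with
      | tau hs h' => exact Or.inr (Or.inl (.tau (.seqStep (by simp) hs) (Or.inl (Or.inl ⟨h', hb⟩))))
      | ev hs h' => exact Or.inr (Or.inl (.ev (.seqStep (by simp) hs) (Or.inl (Or.inl ⟨h', hb⟩))))
    · simp at hb
  · rcases hP.tr _ ht with h | h | ⟨h, P', hst⟩
    · simp at h
    · cases h with
      | tau hst h' =>
        exact Or.inr (Or.inl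
          (.tau (.seqStep (by simp) hst) (Or.inl (Or.inr ⟨t, s, b, h', hs, rfl⟩))))
      | ev hst h' =>
        exact Or.inr (Or.inl
          (.ev (.seqStep (by simp) hst) (Or.inl (Or.inr ⟨_, s, b, h', hs, rfl⟩))))
    · obtain rfl := (Prod.mk.inj h).1
      exact Or.inr (Or.inl (.tau (.seqTick hst) hs))
  · exact (hdv _ h).of_dv

theorem Expands.hide {P : Term α} {A : Set α} (hP : Expands P) : Expands (.hide P A) := by
  have hdv : ∀ p ∈ (denot (.hide P A)).dv, Unfold (fun Q => (denot Q).dv) (.hide P A) p := by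
    rintro _ (⟨t, r, b, h, rfl⟩ | ⟨w, N, r, b, hw, hN, rfl⟩)
    · generalize hp : (t, false) = p at h
      cases hP.dv _ h with
      | tau hs h' =>
        subst hp
        exact .tau (.hideOut (by simp [Label.In]) hs) (Or.inl ⟨t, r, b, h', rfl⟩)
      | @ev P' a s c hs h' =>
        obtain ⟨rfl, rfl⟩ := Prod.mk.inj hp
        by_cases ha : a ∈ A
        · rw [erase_cons_of_mem ha]
          exact .tau (.hideIn ha hs) (Or.inl ⟨s, r, b, h', rfl⟩)
        · rw [erase_cons_of_notMem ha]
          exact .ev (.hideOut ha hs) (Or.inl ⟨s, r, b, h', rfl⟩)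
    · rcases infTraces_step hP hw with ⟨P', hs, hw'⟩ | ⟨P', hs, hw'⟩
      · exact .tau (.hideOut (by simp [Label.In]) hs) (Or.inr ⟨w, N, r, b, hw', hN, rfl⟩)
      · have hN' : ∀ n, N - 1 ≤ n → w (n + 1) ∈ A := fun n hn => hN _ (by omega)
        by_cases ha : w 0 ∈ A
        · refine .tau (.hideIn ha hs) (Or.inr ⟨_, N - 1, r, b, hw', hN', ?_⟩)
          cases N with
          | zero => rfl
          | succ N => rw [pref_succ, erase_cons_of_mem ha]; rfl
        · cases N with
          | zero => exact absurd (hN 0 le_rfl) ha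
          | succ N =>
            rw [pref_succ, erase_cons_of_notMem ha]
            exact .ev (.hideOut ha hs) (Or.inr ⟨_, N, r, b, hw', hN', rfl⟩)
  refine ⟨?_, hdv⟩
  rintro _ (⟨t, b, h, rfl⟩ | h)
  · generalize hp : (t, b) = p at h
    rcases hP.tr _ h with rfl | h | ⟨rfl, P', hs⟩
    · obtain ⟨rfl, rfl⟩ := Prod.mk.inj hp
      exact Or.inl rfl
    · cases h with
      | tau hs h' =>
        subst hp
        exact Or.inr (Or.inl (.tau (.hideOut (by simp [Label.In]) hs) (Or.inl ⟨t, b, h', rfl⟩)))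
      | @ev P' a s c hs h' =>
        obtain ⟨rfl, rfl⟩ := Prod.mk.inj hp
        by_cases ha : a ∈ A
        · rw [erase_cons_of_mem ha]
          exact Or.inr (Or.inl (.tau (.hideIn ha hs) (Or.inl ⟨s, b, h', rfl⟩)))
        · rw [erase_cons_of_notMem ha]
          exact Or.inr (Or.inl (.ev (.hideOut ha hs) (Or.inl ⟨s, b, h', rfl⟩)))
    · obtain ⟨rfl, rfl⟩ := Prod.mk.inj hp
      exact Or.inr (Or.inr ⟨rfl, _, .hideOut (by simp [Label.In]) hs⟩)
  · exact (hdv _ h).of_dv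

theorem Expands.rename {P : Term α} {R : α → α → Prop} (hP : Expands P) :
    Expands (.rename P R) := by
  have hdv : ∀ p ∈ (denot (.rename P R)).dv,
      Unfold (fun Q => (denot Q).dv) (.rename P R) p := by
    rintro _ ⟨s, t, r, b, h, hR, rfl⟩
    generalize hp : (s, false) = p at h
    cases hP.dv _ h with
    | tau hs h' =>
      subst hp
      exact .tau (.renameTau hs) ⟨s, t, r, b, h', hR, rfl⟩
    | @ev P' a s c hs h' =>
      obtain ⟨rfl, rfl⟩ := Prod.mk.inj hp
      cases hR with
      | cons hab hR => exact .ev (.renameEv hab hs) ⟨s, _, r, b, h', hR, rfl⟩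
  refine ⟨?_, hdv⟩
  rintro _ (⟨s, t, b, h, hR, rfl⟩ | h)
  · generalize hp : (s, b) = p at h
    rcases hP.tr _ h with rfl | h | ⟨rfl, P', hs⟩
    · obtain ⟨rfl, rfl⟩ := Prod.mk.inj hp
      cases hR
      exact Or.inl rfl
    · cases h with
      | tau hs h' =>
        subst hp
        exact Or.inr (Or.inl (.tau (.renameTau hs) (Or.inl ⟨s, t, b, h', hR, rfl⟩)))
      | @ev P' a s c hs h' =>
        obtain ⟨rfl, rfl⟩ := Prod.mk.inj hp
        cases hR with
        | cons hab hR =>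
          exact Or.inr (Or.inl (.ev (.renameEv hab hs) (Or.inl ⟨s, _, b, h', hR, rfl⟩)))
    · obtain ⟨rfl, rfl⟩ := Prod.mk.inj hp
      cases hR
      exact Or.inr (Or.inr ⟨rfl, _, .renameTick hs⟩)
  · exact (hdv _ h).of_dv

/-- Only the first transition has to be found. A recursion makes its silent step to the unfolding,
whose denotation contains its own, so nothing need be known about the body, which may be open. -/
theorem IsSeqProc.expands {P : Term α} (h : IsSeqProc P) : Expands P := by
  induction P with
  | STOP => exact ⟨fun p hp => Or.inl hp, fun p hp => hp.elim⟩
  | SKIP =>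
    refine ⟨fun p hp => ?_, fun p hp => hp.elim⟩
    rcases hp with hp | hp
    · exact Or.inl hp
    · exact Or.inr (Or.inr ⟨hp, _, .SKIP⟩)
  | DIV | par => exact nomatch h.1
  | var X => exact absurd h.2 (Set.singleton_ne_empty X)
  | pre a P => exact .pre a P
  | intChoice P Q => exact .intChoice P Q
  | extChoice P Q ihP ihQ => exact .extChoice (ihP h.of_extChoice.1) (ihQ h.of_extChoice.2)
  | seq P Q ihP => exact .seq (ihP h.of_seq.1)
  | hide P A ih => exact .hide (ih h.of_hide)
  | rename P R ih => exact .rename (ih h.of_rename)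
  | mu X P =>
    have hs := denot_mu_sub h.2
    exact ⟨fun p hp => Or.inr (Or.inl (.tau (.mu X P) (hs.1 hp))),
      fun p hp => .tau (.mu X P) (hs.2 hp)⟩

/-! ### Sequential processes without reachable divergence -/

/-- No reachable state has an infinite path of silent transitions. -/
def Convergent (P : Term α) : Prop := ∀ Q, Reachable P Q → ¬ Diverges Q

theorem Convergent.step {P P' : Term α} {l : Label α} (h : Convergent P) (hs : Step P l P') :
    Convergent P' := fun Q hQ => h Q (.head ⟨l, hs⟩ hQ)

theorem Convergent.acc {P : Term α} (h : Convergent P) :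
    Acc (fun Q' Q : Term α => Step Q .tau Q') P := by
  by_contra hacc
  exact h P .refl (not_acc_iff_exists_descending_chain.1 hacc)

/-- A divergence always unfolds into another one after a transition. Visible transitions shorten the
trace and silent ones descend in a well-founded relation, so this cannot go on for ever. -/
theorem IsSeqProc.notMem_dv {P : Term α} (hP : IsSeqProc P) (hc : Convergent P) (s : List α)
    (b : Bool) : (s, b) ∉ (denot P).dv := by
  induction s generalizing P with
  | nil =>
    have hacc := hc.acc
    induction hacc with
    | intro P _ ih =>
      intro hmem
      cases hP.expands.dv _ hmem with
      | tau hs h => exact ih _ hs (hP.step hs) (hc.step hs) h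
  | cons a s ihs =>
    have hacc := hc.acc
    induction hacc with
    | intro P _ ih =>
      intro hmem
      cases hP.expands.dv _ hmem with
      | tau hs h => exact ih _ hs (hP.step hs) (hc.step hs) h
      | ev hs h => exact ihs (hP.step hs) (hc.step hs) h

theorem IsSeqProc.infTraces_visible_step {P : Term α} (hP : IsSeqProc P) (hc : Convergent P)
    {w : ℕ → α} (hw : w ∈ infTraces P) :
    ∃ Q Q', PathIn ∅ P Q ∧ Step Q (.ev (w 0)) Q' ∧ IsSeqProc Q' ∧ Convergent Q' ∧
      (fun i => w (i + 1)) ∈ infTraces Q' := by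
  have hacc := hc.acc
  induction hacc with
  | intro P _ ih =>
    rcases infTraces_step hP.expands hw with ⟨P', hs, hw'⟩ | ⟨P', hs, hw'⟩
    · obtain ⟨Q, Q', h, hrest⟩ := ih _ hs (hP.step hs) (hc.step hs) hw'
      exact ⟨Q, Q', .head ⟨_, Or.inl rfl, hs⟩ h, hrest⟩
    · exact ⟨P, P', .refl, hs, hP.step hs, hc.step hs, hw'⟩

theorem PathIn.mono {L L' : Set α} (h : L ⊆ L') {P Q : Term α} (hp : PathIn L P Q) :
    PathIn L' P Q := by
  refine Relation.ReflTransGen.mono ?_ _ _ hp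
  rintro S S' ⟨l, hl, hs⟩
  refine ⟨l, hl.imp_right fun hl => ?_, hs⟩
  cases l with
  | ev a => exact h hl
  | _ => exact hl

theorem PathIn.reachable {L : Set α} {P Q : Term α} (hp : PathIn L P Q) : Reachable P Q :=
  Relation.ReflTransGen.mono (fun _ _ ⟨l, _, hs⟩ => ⟨l, hs⟩) _ _ hp

/-- An infinite trace is performed along a path; `Q n` is the state before the silent transitions
which precede the `n`-th event. -/
theorem IsSeqProc.exists_run {P : Term α} (hP : IsSeqProc P) (hc : Convergent P)
    {w : ℕ → α} (hw : w ∈ infTraces P) :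
    ∃ Q Q' : ℕ → Term α, Q 0 = P ∧
      ∀ n, PathIn ∅ (Q n) (Q' n) ∧ Step (Q' n) (.ev (w n)) (Q (n + 1)) := by
  -- The states at time `n` carry the invariant that permits the next step, so the run can be built
  -- by recursion on `n`.
  let S : ℕ → Type u := fun n =>
    {Q : Term α // IsSeqProc Q ∧ Convergent Q ∧ (fun i => w (i + n)) ∈ infTraces Q}
  have next : ∀ n (Q : S n), ∃ Q' : Term α, ∃ Q'' : S (n + 1),
      PathIn ∅ Q.1 Q' ∧ Step Q' (.ev (w n)) Q''.1 := by
    rintro n ⟨Q, h1, h2, h3⟩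
    obtain ⟨Q', Q'', hp, hs, h1', h2', h3'⟩ := h1.infTraces_visible_step h2 h3
    refine ⟨Q', ⟨Q'', h1', h2', ?_⟩, hp, by simpa using hs⟩
    rwa [show (fun i => w (i + (n + 1))) = fun i => w (i + 1 + n) by
      funext i; rw [Nat.add_assoc, Nat.add_comm n 1]]
  choose mid nxt hmid hnxt using next
  let run : ∀ n, S n := fun n => Nat.rec ⟨P, hP, hc, hw⟩ (fun n Q => nxt n Q) n
  exact ⟨fun n => (run n).1, fun n => mid n (run n), rfl,
    fun n => ⟨hmid n (run n), hnxt n (run n)⟩⟩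

theorem exists_infinite_fiber [Finite α] (w : ℕ → α) {I : Set ℕ} (hI : I.Infinite) :
    ∃ a, {n | n ∈ I ∧ w n = a}.Infinite := by
  by_contra! h
  exact hI ((Set.finite_iUnion h).subset fun n hn => Set.mem_iUnion.2 ⟨w n, hn, rfl⟩)

theorem IsSeqProc.exists_phiSeq [Finite α] {P : Term α} (hP : IsSeqProc P) (hc : Convergent P)
    {w : ℕ → α} (hw : w ∈ infTraces P) :
    ∃ p ∈ phiSeq P, FairIn w p.1 ∧ CofairIn w p.2 := by
  obtain ⟨Q, Q', h0, hrun⟩ := hP.exists_run hc hw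
  set L : Set α := {a | {n | w n = a}.Infinite} with hL
  have hreach : ∀ n, Reachable P (Q n) := by
    intro n
    induction n with
    | zero => rw [h0]; exact .refl
    | succ n ih => exact (ih.trans (hrun n).1.reachable).tail ⟨_, (hrun n).2⟩
  -- The shift by one is essential: `Q 0` is the initial process, which need not be entered by a
  -- visible transition.
  have hpost : ∀ n, Q (n + 1) ∈ Term.post P Term.var := fun n =>
    have hr := (hreach n).trans (hrun n).1.reachable
    post_reachable hr hP ((post_step (hrun n).2 (hP.reachable hr)).2 _ rfl)
  have : Finite (Term.post P Term.var) := (Term.post_finite P Term.var).to_subtype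
  obtain ⟨q, hq⟩ := exists_infinite_fiber
    (fun n => (⟨Q (n + 1), hpost n⟩ : Term.post P Term.var)) Set.infinite_univ
  have hqinf : ∀ m, ∃ n, m < n ∧ Q n = q := by
    intro m
    obtain ⟨n, hn, hmn⟩ := hq.exists_gt m
    exact ⟨n + 1, by omega, congrArg Subtype.val hn.2⟩
  -- There are finitely many events outside `L`, each with finitely many occurrences.
  obtain ⟨N, hN⟩ : ∃ N, ∀ n, N ≤ n → w n ∈ L := by
    have hfin : {n | w n ∉ L}.Finite := by
      refine (Set.Finite.biUnion (Set.toFinite Lᶜ) (t := fun a => {n | w n = a}) ?_).subset ?_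
      · exact fun a ha => Set.not_infinite.1 ha
      · exact fun n hn => Set.mem_biUnion (x := w n) hn rfl
    obtain ⟨N, hN⟩ := hfin.bddAbove
    exact ⟨N + 1, fun n hn => by_contra fun h => absurd (hN h) (by omega)⟩
  have hstep : ∀ n, N ≤ n → PathIn L (Q' n) (Q (n + 1)) := fun n hn =>
    .single ⟨.ev (w n), Or.inr (hN n hn), (hrun n).2⟩
  have htau : ∀ n, PathIn L (Q n) (Q' n) := fun n => (hrun n).1.mono (Set.empty_subset L)
  have hpath : ∀ m n, N ≤ m → m ≤ n → PathIn L (Q m) (Q n) := by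
    intro m n hm hmn
    induction n, hmn using Nat.le_induction with
    | base => exact .refl
    | succ n hmn ih => exact (ih.trans (htau n)).trans (hstep n (by omega))
  obtain ⟨k, hk, hkq⟩ := hqinf N
  refine ⟨(L, Lᶜ), ⟨L, ?_, rfl, Q k, hreach k, ?_⟩, fun a ha => ha,
    fun a ha => Set.not_infinite.1 ha⟩
  · obtain ⟨a, ha⟩ := exists_infinite_fiber w Set.infinite_univ
    exact ⟨a, ha.mono fun n hn => hn.2⟩
  -- The run visits `q` at time `k`, performs `a` at a later time `n`, and is back in `q` at a time
  -- `m > n`. This cycle puts both ends of the `a`-transition into the component of `Q k`.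
  · intro a ha
    obtain ⟨n, hn, hkn⟩ := Set.Infinite.exists_gt ha k
    obtain ⟨m, hnm, hm⟩ := hqinf n
    have h1 : PathIn L (Q k) (Q' n) := (hpath k n hk.le hkn.le).trans (htau n)
    have h2 : PathIn L (Q (n + 1)) (Q k) := by
      rw [hkq, ← hm]
      exact hpath (n + 1) m (by omega) hnm
    have h3 := hstep n (by omega)
    have hn' : w n = a := hn
    exact ⟨Q' n, Q (n + 1), hn' ▸ (hrun n).2, ⟨h1, h3.trans h2⟩, ⟨h1.trans h3, h2⟩⟩

/-! ### Infinite sequences -/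

/-- The limit is taken pointwise along a nonprincipal ultrafilter, on which each coordinate is
almost surely constant because `β` is finite. Finitely many coordinates still agree with the limit
on a set of the ultrafilter, which contains arbitrarily large `n`. -/
theorem exists_ultralimit {β : Type*} [Finite β] (f : ℕ → ℕ → β) :
    ∃ g : ℕ → β, ∀ m, ∃ n, m ≤ n ∧ ∀ i < m, f n i = g i := by
  have h : ∀ i, ∃ b, ∀ᶠ n in (Filter.hyperfilter ℕ : Filter ℕ), f n i = b := by
    intro i
    obtain ⟨b, hb⟩ := ((Filter.hyperfilter ℕ).map fun n => f n i).eq_pure_of_finite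
    refine ⟨b, ?_⟩
    have : {b} ∈ (Filter.hyperfilter ℕ).map fun n => f n i := by rw [hb]; exact rfl
    exact this
  choose g hg using h
  refine ⟨g, fun m => ?_⟩
  have h1 : ∀ᶠ n in (Filter.hyperfilter ℕ : Filter ℕ), ∀ i ∈ Set.Iio m, f n i = g i :=
    (Filter.eventually_all_finite (Set.finite_Iio m)).2 fun i _ => hg i
  have h2 : ∀ᶠ n in (Filter.hyperfilter ℕ : Filter ℕ), m ≤ n :=
    Filter.hyperfilter_le_cofinite
      (Nat.cofinite_eq_atTop ▸ Filter.eventually_ge_atTop m)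
  obtain ⟨n, hn1, hn2⟩ := (h1.and h2).exists
  exact ⟨n, hn2, hn1⟩

theorem length_pref (w : ℕ → α) (n : ℕ) : (pref w n).length = n := by
  simp [pref]

theorem pref_getElem? (w : ℕ → α) {n i : ℕ} (h : i < n) : (pref w n)[i]? = some (w i) := by
  simp [pref, h]

theorem pref_add (w : ℕ → α) (m n : ℕ) :
    pref w (m + n) = pref w m ++ pref (fun i => w (i + m)) n := by
  rw [pref, List.range_add, List.map_append, List.map_map]
  simp [pref, Function.comp_def, Nat.add_comm]

theorem pref_succ' (w : ℕ → α) (n : ℕ) : pref w (n + 1) = pref w n ++ [w n] := by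
  simp [pref, List.range_succ]

/-- Koenig's lemma for a sequence of lists of unbounded length over a finite set. -/
theorem exists_limit_of_lists {β : Type*} [Finite β] (l : ℕ → List β)
    (hl : ∀ n, n ≤ (l n).length) :
    ∃ u : ℕ → β, ∀ m, ∃ n, m ≤ n ∧ ∃ r, l n = pref u m ++ r := by
  -- Lists are padded with `none`, which keeps the value set finite; the growing lengths exclude
  -- `none` from the limit.
  obtain ⟨g, hg⟩ := exists_ultralimit fun n i => (l n)[i]?
  have hsome : ∀ i, ∃ b, g i = some b := by
    intro i
    obtain ⟨n, hn, h⟩ := hg (i + 1)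
    have hi : i < (l n).length := by have := hl n; omega
    exact ⟨(l n)[i], by rw [← h i i.lt_succ_self, List.getElem?_eq_getElem hi]⟩
  choose u hu using hsome
  refine ⟨u, fun m => ?_⟩
  obtain ⟨n, hn, h⟩ := hg m
  refine ⟨n, hn, (l n).drop m, ?_⟩
  have : (l n).take m = pref u m := by
    refine List.ext_getElem? fun i => ?_
    by_cases hi : i < m
    · rw [pref_getElem? u hi, List.getElem?_take_of_lt hi, h i hi, hu]
    · rw [List.getElem?_eq_none, List.getElem?_eq_none]
      · rw [length_pref]; omega
      · rw [List.length_take]; omega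
  rw [← this, List.take_append_drop]

/-- The bridge between filtering finite traces and passing to a subsequence of an infinite one, used
for hiding and for the components of a parallel composition. -/
theorem filter_pref {β : Type*} (v : ℕ → β) (q : β → Prop) [DecidablePred q] (n : ℕ) :
    (pref v n).filter (fun b => decide (q b)) =
      pref (fun k => v (Nat.nth (fun i => q (v i)) k)) (Nat.count (fun i => q (v i)) n) := by
  induction n with
  | zero => simp [pref]
  | succ n ih =>
    rw [pref_succ', List.filter_append, ih, Nat.count_succ]
    by_cases h : q (v n)
    · have := Nat.nth_count (p := fun i => q (v i)) h
      simp [h, pref_succ', this]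
    · simp [h]

theorem TD.Coherent.subsequence_mem {β : Type*} {x : TD α} (v : ℕ → β) (g : β → α)
    (q : β → Prop) [DecidablePred q] (hq : {n | q (v n)}.Infinite)
    (h : ∀ m, (((pref v m).filter (fun b => decide (q b))).map g, false) ∈ x.tr) (k : ℕ) :
    (pref (fun k => g (v (Nat.nth (fun i => q (v i)) k))) k, false) ∈ x.tr := by
  -- Cutting at the position of the selected entry with index `k` leaves exactly `k` selected
  -- entries before the cut.
  have := h (Nat.nth (fun i => q (v i)) k)
  rw [filter_pref, Nat.count_nth_of_infinite hq] at this
  simpa [pref, Function.comp_def] using this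

theorem FairIn.of_comp {w : ℕ → α} {e : ℕ → ℕ} (he : e.Injective) {F : Set α}
    (h : FairIn (fun k => w (e k)) F) : FairIn w F := fun a ha =>
  ((h a ha).image he.injOn).mono (by rintro _ ⟨k, hk, rfl⟩; exact hk)

theorem CofairIn.of_comp {w : ℕ → α} {e : ℕ → ℕ} (he : (Set.range e)ᶜ.Finite) {C : Set α}
    (h : CofairIn (fun k => w (e k)) C) : CofairIn w C := fun a ha => by
  refine (((h a ha).image e).union he).subset fun n hn => ?_
  by_cases hr : n ∈ Set.range e
  · obtain ⟨k, rfl⟩ := hr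
    exact Or.inl ⟨k, hn, rfl⟩
  · exact Or.inr hr

theorem FairIn.of_shift {w : ℕ → α} {k : ℕ} {F : Set α} (h : FairIn (fun i => w (i + k)) F) :
    FairIn w F :=
  FairIn.of_comp (add_left_injective k) h

theorem CofairIn.of_shift {w : ℕ → α} {k : ℕ} {C : Set α}
    (h : CofairIn (fun i => w (i + k)) C) : CofairIn w C := by
  refine CofairIn.of_comp ((Set.finite_Iio k).subset fun n hn => ?_) h
  by_contra hk
  exact hn ⟨n - k, Nat.sub_add_cancel (not_lt.1 hk)⟩

/-! ### Infinite traces of composite processes -/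

/-- Every infinite trace of `x` is fair and co-fair for some pair of `Φ`. -/
def TD.FairFor (x : TD α) (Φ : Set (Set α × Set α)) : Prop :=
  ∀ w : ℕ → α, (∀ n, (pref w n, false) ∈ x.tr) → ∃ p ∈ Φ, FairIn w p.1 ∧ CofairIn w p.2

theorem TD.FairFor.pre {a : α} {x : TD α} {Φ : Set (Set α × Set α)} (hx : x.FairFor Φ) :
    (TD.pre a x).FairFor Φ := by
  intro w hw
  obtain ⟨p, hp, h1, h2⟩ := hx (fun i => w (i + 1)) fun n => by
    rcases hw (n + 1) with h | ⟨s, b, h, e⟩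
    · simp [pref_succ] at h
    · simp only [pref_succ, Prod.mk.injEq, List.cons.injEq] at e
      obtain ⟨⟨-, rfl⟩, rfl⟩ := e
      exact h
  exact ⟨p, hp, h1.of_shift, h2.of_shift⟩

/-- Once `x` refuses a prefix it refuses all longer ones, so these, and then all prefixes, belong to
`y`. -/
theorem TD.FairFor.choice {x y : TD α} {Φ Ψ : Set (Set α × Set α)} (hx : x.FairFor Φ)
    (hy : y.FairFor Ψ) (hxc : x.Coherent) (hyc : y.Coherent) :
    (TD.choice x y).FairFor (Φ ∪ Ψ) := by
  intro w hw
  by_cases h : ∀ n, (pref w n, false) ∈ x.tr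
  · obtain ⟨p, hp, h'⟩ := hx w h
    exact ⟨p, Or.inl hp, h'⟩
  · obtain ⟨N, hN⟩ := not_forall.1 h
    obtain ⟨p, hp, h'⟩ := hy w fun n => by
      rcases hw (max n N) with h | h
      · exact absurd (hxc.pref_mem (le_max_right n N) h) hN
      · exact hyc.pref_mem (le_max_left n N) h
    exact ⟨p, Or.inr hp, h'⟩

/-- If `x` refuses the prefix of length `N`, then it must terminate before `N` in every longer
prefix. Some handover point `j < N` is therefore used infinitely often, and the tail of `w` after
`j` is an infinite trace of `y`. -/
theorem TD.FairFor.seq {x y : TD α} {Φ Ψ : Set (Set α × Set α)} (hx : x.FairFor Φ)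
    (hy : y.FairFor Ψ) (hxc : x.Coherent) (hyc : y.Coherent) (hxd : x.dv = ∅) (hyd : y.dv = ∅) :
    (TD.seq x y).FairFor (Φ ∪ Ψ) := by
  intro w hw
  by_cases h : ∀ n, (pref w n, false) ∈ x.tr
  · obtain ⟨p, hp, h'⟩ := hx w h
    exact ⟨p, Or.inl hp, h'⟩
  obtain ⟨N, hN⟩ := not_forall.1 h
  have key : ∀ n, ∃ k : Fin N, (pref (fun i => w (i + k)) n, false) ∈ y.tr := by
    intro n
    rcases hw (N + n) with (⟨h, -⟩ | ⟨t, s, b, ht, hs, e⟩) | h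
    · exact absurd (hxc.pref_mem (Nat.le_add_right N n) h) hN
    · obtain ⟨e', rfl⟩ := Prod.mk.inj e
      have hlt : t.length < N := by
        by_contra hle
        refine hN (hxc.prefix_mem _ (t.drop N) true ?_)
        have : pref w N = t.take N := by
          have := congrArg (List.take N) e'
          rwa [pref_add, List.take_left' (length_pref w N),
            List.take_append_of_le_length (not_lt.1 hle)] at this
        rwa [this, List.take_append_drop]
      refine ⟨⟨t.length, hlt⟩, ?_⟩
      obtain ⟨d, hd⟩ := Nat.exists_eq_add_of_lt hlt
      have hsplit : N + n = t.length + (n + (d + 1)) := by omega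
      rw [hsplit, pref_add w t.length] at e'
      have := (List.append_inj e' (length_pref w _)).2
      exact hyc.pref_mem (Nat.le_add_right n (d + 1)) (this ▸ hs)
    · rcases h with h | ⟨t, s, b, -, h, -⟩
      · rw [hxd] at h; exact h.elim
      · rw [hyd] at h; exact h.elim
  choose k hk using key
  obtain ⟨j, hj⟩ := exists_infinite_fiber k Set.infinite_univ
  obtain ⟨p, hp, h1, h2⟩ := hy (fun i => w (i + j)) fun n => by
    obtain ⟨m, hm, hnm⟩ := hj.exists_gt n
    have := hk m
    rw [hm.2] at this
    exact hyc.pref_mem hnm.le this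
  exact ⟨p, Or.inr hp, h1.of_shift, h2.of_shift⟩

/-- Hiding can only create divergence from an infinite trace that ends up inside `A`, but every
infinite trace is fair to some event outside `A`. -/
theorem TD.FairFor.hideDv_eq_empty {A : Set α} {x : TD α} {Φ : Set (Set α × Set α)}
    (hx : x.FairFor Φ) (hxd : x.dv = ∅) (hΦ : ∀ p ∈ Φ, (p.1 \ A).Nonempty) :
    TD.hideDv A x = ∅ := by
  refine Set.eq_empty_of_forall_notMem ?_
  rintro _ (⟨t, r, b, h, -⟩ | ⟨w, N, r, b, hw, hN, -⟩)
  · rw [hxd] at h; exact h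
  · obtain ⟨p, hp, h1, -⟩ := hx w hw
    obtain ⟨a, ha, haA⟩ := hΦ p hp
    obtain ⟨n, hn, hlt⟩ := (h1 a ha).exists_gt N
    exact haA (hn ▸ hN n hlt.le)

theorem TD.FairFor.hide [Finite α] {A : Set α} {x : TD α} {Φ : Set (Set α × Set α)}
    (hx : x.FairFor Φ) (hxc : x.Coherent) (hxd : x.dv = ∅)
    (hΦ : ∀ p ∈ Φ, (p.1 \ A).Nonempty) :
    (TD.hide A x).FairFor (phiHide A Φ) := by
  classical
  intro w hw
  have key : ∀ n, ∃ t, (t, false) ∈ x.tr ∧ erase A t = pref w n := by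
    intro n
    rcases hw n with ⟨t, b, ht, e⟩ | h
    · obtain ⟨e', rfl⟩ := Prod.mk.inj e
      exact ⟨t, ht, e'.symm⟩
    · rw [hx.hideDv_eq_empty hxd hΦ] at h
      exact h.elim
  choose t ht hte using key
  obtain ⟨u, hu⟩ := exists_limit_of_lists t fun n => by
    calc n = (erase A (t n)).length := by rw [hte, length_pref]
      _ ≤ (t n).length := List.length_filter_le _ _
  obtain ⟨p, hp, h1, h2⟩ := hx u fun m => by
    obtain ⟨n, -, r, hr⟩ := hu m
    exact hxc.prefix_mem _ r false (hr ▸ ht n)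
  set e : ℕ → ℕ := Nat.nth fun i => u i ∉ A with he
  -- The flag condition again: the limit trace `u` keeps performing events outside `A`, so erasing
  -- `A` leaves an infinite sequence.
  have hinf : {i | u i ∉ A}.Infinite := by
    obtain ⟨a, ha, haA⟩ := hΦ p hp
    exact (h1 a ha).mono fun n hn => by rw [Set.mem_ofPred_eq, show u n = a from hn]; exact haA
  have hwu : ∀ k, w k = u (e k) := by
    intro k
    -- The prefix of `u` of length `e (k + 1)` has exactly `k + 1` events outside `A`, enough to see
    -- the event of `w` at index `k`.
    obtain ⟨n, -, r, hr⟩ := hu (e (k + 1))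
    have h3 : pref w n = pref (fun k => u (e k)) (k + 1) ++ erase A r := by
      rw [← hte n, hr, erase_append, erase, erase, filter_pref u (fun a => a ∉ A),
        he, Nat.count_nth_of_infinite hinf]
    have hkn : k < n := by
      have := congrArg List.length h3
      simp only [length_pref, List.length_append] at this
      omega
    have h4 := congrArg (fun l => l[k]?) h3
    simp only [pref_getElem? w hkn] at h4
    rw [List.getElem?_append_left (by rw [length_pref]; omega),
      pref_getElem? _ k.lt_succ_self] at h4
    exact Option.some.inj h4
  have heA : ∀ k, u (e k) ∉ A := fun k => Nat.nth_mem_of_infinite hinf k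
  have hrange : Set.range e = {i | u i ∉ A} := Nat.range_nth_of_infinite hinf
  refine ⟨_, ⟨p, hp, rfl⟩, ?_, ?_⟩
  · rintro a ⟨ha, haA⟩
    refine Set.Infinite.of_image e ((h1 a ha).mono fun n hn => ?_)
    have : n ∈ Set.range e := by rw [hrange, Set.mem_ofPred_eq, show u n = a from hn]; exact haA
    obtain ⟨k, rfl⟩ := this
    exact ⟨k, (hwu k).trans hn, rfl⟩
  · rintro a (ha | ha)
    · refine Set.Finite.of_finite_image ((h2 a ha).subset ?_) (Nat.nth_injective hinf).injOn
      rintro _ ⟨k, hk, rfl⟩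
      exact (hwu k).symm.trans hk
    · refine Set.finite_empty.subset fun k hk => heA k ?_
      rw [← hwu k, show w k = a from hk]
      exact ha

theorem TD.renameDv_eq_empty {R : α → α → Prop} {x : TD α} (hxd : x.dv = ∅) :
    TD.renameDv R x = ∅ := by
  refine Set.eq_empty_of_forall_notMem ?_
  rintro _ ⟨s, t, r, b, h, -, -⟩
  rw [hxd] at h; exact h

theorem TD.FairFor.rename [Finite α] {R : α → α → Prop} {x : TD α} {Φ : Set (Set α × Set α)}
    (hx : x.FairFor Φ) (hxc : x.Coherent) (hxd : x.dv = ∅) :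
    (TD.rename R x).FairFor (phiRename R Φ) := by
  intro w hw
  have key : ∀ n, ∃ s, (s, false) ∈ x.tr ∧ List.Forall₂ R s (pref w n) := by
    intro n
    rcases hw n with ⟨s, t, b, hs, hR, e⟩ | h
    · obtain ⟨rfl, rfl⟩ := Prod.mk.inj e
      exact ⟨s, hs, hR⟩
    · rw [TD.renameDv_eq_empty hxd] at h
      exact h.elim
  choose s hs hR using key
  obtain ⟨u, hu⟩ := exists_limit_of_lists s fun n => by
    rw [(hR n).length_eq, length_pref]
  obtain ⟨p, hp, h1, h2⟩ := hx u fun m => by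
    obtain ⟨n, -, r, hr⟩ := hu m
    exact hxc.prefix_mem _ r false (hr ▸ hs n)
  have hRuw : ∀ i, R (u i) (w i) := by
    intro i
    obtain ⟨n, hn, r, hr⟩ := hu (i + 1)
    have h3 : (s n)[i]? = some (u i) := by
      rw [hr, List.getElem?_append_left (by rw [length_pref]; omega),
        pref_getElem? u i.lt_succ_self]
    have h4 : (pref w n)[i]? = some (w i) := pref_getElem? w hn
    obtain ⟨h3l, h3⟩ := List.getElem?_eq_some_iff.1 h3
    obtain ⟨h4l, h4⟩ := List.getElem?_eq_some_iff.1 h4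
    have := (hR n).get h3l h4l
    simpa only [List.get_eq_getElem, h3, h4] using this
  refine ⟨({b | ∃ a ∈ p.1, {n | u n = a ∧ w n = b}.Infinite}, {b | {a | R a b} ⊆ p.2}),
    ⟨p, hp, ?_, ?_, rfl⟩, ?_, ?_⟩
  · intro a ha
    obtain ⟨b, hb⟩ := exists_infinite_fiber w (h1 a ha)
    obtain ⟨n, hn⟩ := hb.nonempty
    refine ⟨b, ⟨a, ha, hb⟩, ?_⟩
    have h3 := hRuw n
    rwa [show u n = a from hn.1, hn.2] at h3
  · rintro b ⟨a, ha, hab⟩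
    obtain ⟨n, hn1, hn2⟩ := hab.nonempty
    have h3 := hRuw n
    rw [hn1, hn2] at h3
    exact ⟨a, ha, h3⟩
  · rintro b ⟨a, ha, hab⟩
    exact hab.mono fun n hn => hn.2
  · intro b hb
    refine (Set.Finite.biUnion (Set.toFinite {a | R a b}) (t := fun a => {n | u n = a})
      fun a ha => h2 a (hb ha)).subset fun n hn => ?_
    refine Set.mem_biUnion (x := u n) ?_ rfl
    have h3 := hRuw n
    rwa [show w n = b from hn] at h3

/-! ### Parallel composition -/

theorem TD.parDv_eq_empty {A : Set α} {x y : TD α} (hxd : x.dv = ∅) (hyd : y.dv = ∅) :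
    TD.parDv A x y = ∅ := by
  refine Set.eq_empty_of_forall_notMem ?_
  rintro _ ⟨s, t, w, r, b, -, -, -, h | h, -⟩
  · rw [hxd] at h; exact h
  · rw [hyd] at h; exact h

open Classical in
/-- The events of an interleaving in which the left component takes part, where the Boolean flags
say which component performs an event that is not synchronised. -/
noncomputable def leftPart (A : Set α) (l : List (α × Bool)) : List α :=
  (l.filter fun p => decide (p.1 ∈ A ∨ p.2 = true)).map Prod.fst

open Classical in
/-- The events of an interleaving in which the right component takes part. -/
noncomputable def rightPart (A : Set α) (l : List (α × Bool)) : List α :=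
  (l.filter fun p => decide (p.1 ∈ A ∨ p.2 = false)).map Prod.fst

/-- The flags encode both components relative to the known sequence `w`, so that Koenig's lemma need
only be applied to lists of Booleans. The flag of a synchronised event is irrelevant. -/
theorem Inter.exists_flags {A : Set α} {s t w : List α} (h : Inter A s t w) :
    ∃ c : List Bool, c.length = w.length ∧ s = leftPart A (w.zip c) ∧
      t = rightPart A (w.zip c) := by
  induction h with
  | nil => exact ⟨[], rfl, rfl, rfl⟩
  | left hb _ ih =>
    obtain ⟨c, hc, hs, ht⟩ := ih
    exact ⟨true :: c, by simp [hc], by simp [leftPart, hs], by simp [rightPart, hb, ht]⟩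
  | right hb _ ih =>
    obtain ⟨c, hc, hs, ht⟩ := ih
    exact ⟨false :: c, by simp [hc], by simp [leftPart, hb, hs], by simp [rightPart, ht]⟩
  | sync hb _ ih =>
    obtain ⟨c, hc, hs, ht⟩ := ih
    exact ⟨true :: c, by simp [hc], by simp [leftPart, hs], by simp [rightPart, hb, ht]⟩

/-- An infinite trace of a divergence-free parallel composition is an interleaving of two
finite or infinite traces. -/
theorem TD.par_exists_flags {A : Set α} {x y : TD α} (hxc : x.Coherent) (hyc : y.Coherent)
    (hxd : x.dv = ∅) (hyd : y.dv = ∅) {w : ℕ → α}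
    (hw : ∀ n, (pref w n, false) ∈ (TD.par A x y).tr) :
    ∃ c : ℕ → Bool, ∀ n, (leftPart A (pref (fun i => (w i, c i)) n), false) ∈ x.tr ∧
      (rightPart A (pref (fun i => (w i, c i)) n), false) ∈ y.tr := by
  have key : ∀ n, ∃ c : List Bool, c.length = n ∧ (leftPart A ((pref w n).zip c), false) ∈ x.tr ∧
      (rightPart A ((pref w n).zip c), false) ∈ y.tr := by
    intro n
    rcases hw n with ⟨s, t, v, b, hs, ht, h, e⟩ | h
    · obtain ⟨rfl, rfl⟩ := Prod.mk.inj e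
      obtain ⟨c, hc, rfl, rfl⟩ := h.exists_flags
      exact ⟨c, by rw [hc, length_pref], hs, ht⟩
    · rw [TD.parDv_eq_empty hxd hyd] at h
      exact h.elim
  choose d hd hl hr using key
  obtain ⟨c, hc⟩ := exists_limit_of_lists d fun n => (hd n).ge
  refine ⟨c, fun m => ?_⟩
  obtain ⟨n, hmn, r, hn⟩ := hc m
  obtain ⟨k, rfl⟩ := Nat.exists_eq_add_of_le hmn
  have hz : ∃ r', (pref w (m + k)).zip (d (m + k)) = pref (fun i => (w i, c i)) m ++ r' := by
    rw [hn, pref_add, List.zip_append (by rw [length_pref, length_pref])]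
    exact ⟨_, by rw [show (pref w m).zip (pref c m) = pref (fun i => (w i, c i)) m from
      List.zip_map' ..]⟩
  obtain ⟨r', hr'⟩ := hz
  have hl' := hl (m + k)
  have hr'' := hr (m + k)
  rw [hr', leftPart, List.filter_append, List.map_append] at hl'
  rw [hr', rightPart, List.filter_append, List.map_append] at hr''
  exact ⟨hxc.prefix_mem _ _ _ hl', hyc.prefix_mem _ _ _ hr''⟩

/-- The situation in which only one component performs infinitely many events. -/
theorem fair_of_finite_other {A : Set α} {w : ℕ → α} {I J : Set ℕ} (hI : I.Infinite)
    (hJ : J.Finite) (hIJ : I ∪ J = Set.univ) (hAJ : ∀ n, w n ∈ A → n ∈ J)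
    {p : Set α × Set α} (h1 : FairIn (fun k => w (Nat.nth (· ∈ I) k)) p.1)
    (h2 : CofairIn (fun k => w (Nat.nth (· ∈ I) k)) p.2) :
    p.1 ∩ A = ∅ ∧ FairIn w p.1 ∧ CofairIn w p.2 := by
  have h1' : FairIn w p.1 := FairIn.of_comp (Nat.nth_injective hI) h1
  refine ⟨?_, h1', CofairIn.of_comp (hJ.subset fun n hn => ?_) h2⟩
  · refine Set.eq_empty_of_forall_notMem fun a ha => h1' a ha.1 (hJ.subset fun n hn => ?_)
    exact hAJ n (by rw [show w n = a from hn]; exact ha.2)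
  · have hr : Set.range (Nat.nth (· ∈ I)) = I := Nat.range_nth_of_infinite hI
    rw [hr] at hn
    exact ((Set.ext_iff.1 hIJ n).2 trivial).resolve_left hn

theorem CofairIn.finite_inter {w : ℕ → α} {I : Set ℕ} (hI : I.Infinite) {C : Set α}
    (h : CofairIn (fun k => w (Nat.nth (· ∈ I) k)) C) {a : α} (ha : a ∈ C) :
    {n | n ∈ I ∧ w n = a}.Finite := by
  have hr : Set.range (Nat.nth (· ∈ I)) = I := Nat.range_nth_of_infinite hI
  refine ((h a ha).image (Nat.nth (· ∈ I))).subset ?_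
  rintro n ⟨hn, hna⟩
  rw [← hr] at hn
  obtain ⟨k, rfl⟩ := hn
  exact ⟨k, hna, rfl⟩

/-- The index sets `I` and `J` of the two components cover `ℕ`, and both contain every occurrence of
an event of `A`. If one is finite, the other component performs almost all of `w` and `A` occurs
finitely often, whence the pairs with `F ∩ A = ∅`. If both are infinite, each yields a pair and the
two are combined. -/
theorem TD.FairFor.par {A : Set α} {x y : TD α} {Φ Ψ : Set (Set α × Set α)} (hx : x.FairFor Φ)
    (hy : y.FairFor Ψ) (hxc : x.Coherent) (hyc : y.Coherent) (hxd : x.dv = ∅) (hyd : y.dv = ∅) :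
    (TD.par A x y).FairFor (phiPar A Φ Ψ) := by
  classical
  intro w hw
  obtain ⟨c, hc⟩ := TD.par_exists_flags hxc hyc hxd hyd hw
  set I : Set ℕ := {n | w n ∈ A ∨ c n = true} with hI
  set J : Set ℕ := {n | w n ∈ A ∨ c n = false} with hJ
  have hIJ : I ∪ J = Set.univ := by
    refine Set.eq_univ_of_forall fun n => ?_
    cases h : c n
    · exact Or.inr (Or.inr h)
    · exact Or.inl (Or.inr h)
  have hx' : I.Infinite → ∃ p ∈ Φ, FairIn (fun k => w (Nat.nth (· ∈ I) k)) p.1 ∧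
      CofairIn (fun k => w (Nat.nth (· ∈ I) k)) p.2 := fun h => hx _ fun k =>
    TD.Coherent.subsequence_mem (fun i => (w i, c i)) Prod.fst
      (fun p => p.1 ∈ A ∨ p.2 = true) h (fun m => by
        have := (hc m).1
        unfold leftPart at this
        convert this) k
  have hy' : J.Infinite → ∃ p ∈ Ψ, FairIn (fun k => w (Nat.nth (· ∈ J) k)) p.1 ∧
      CofairIn (fun k => w (Nat.nth (· ∈ J) k)) p.2 := fun h => hy _ fun k =>
    TD.Coherent.subsequence_mem (fun i => (w i, c i)) Prod.fst
      (fun p => p.1 ∈ A ∨ p.2 = false) h (fun m => by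
        have := (hc m).2
        unfold rightPart at this
        convert this) k
  by_cases hIf : I.Finite
  · have hJi : J.Infinite := fun h => Set.infinite_univ (hIJ ▸ hIf.union h)
    obtain ⟨p, hp, h1, h2⟩ := hy' hJi
    obtain ⟨h3, h4⟩ := fair_of_finite_other hJi hIf (Set.union_comm I J ▸ hIJ)
      (fun n hn => Or.inl hn) h1 h2
    exact ⟨p, Or.inr ⟨hp, h3⟩, h4⟩
  by_cases hJf : J.Finite
  · obtain ⟨p, hp, h1, h2⟩ := hx' hIf
    obtain ⟨h3, h4⟩ := fair_of_finite_other hIf hJf hIJ (fun n hn => Or.inl hn) h1 h2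
    exact ⟨p, Or.inl (Or.inr ⟨hp, h3⟩), h4⟩
  obtain ⟨p, hp, hp1, hp2⟩ := hx' hIf
  obtain ⟨q, hq, hq1, hq2⟩ := hy' hJf
  have hF : FairIn w (p.1 ∪ q.1) := by
    rintro a (ha | ha)
    · exact FairIn.of_comp (Nat.nth_injective hIf) hp1 a ha
    · exact FairIn.of_comp (Nat.nth_injective hJf) hq1 a ha
  -- A synchronised event is bounded as soon as one component bounds it, since both take part in it;
  -- any other event must be bounded by both.
  have hC : CofairIn w ((p.2 ∩ A) ∪ (q.2 ∩ A) ∪ ((p.2 \ A) ∩ (q.2 \ A))) := by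
    rintro a ((⟨ha, haA⟩ | ⟨ha, haA⟩) | ⟨ha, ha'⟩)
    · refine (hp2.finite_inter hIf ha).subset fun n hn => ⟨Or.inl ?_, hn⟩
      rw [show w n = a from hn]; exact haA
    · refine (hq2.finite_inter hJf ha).subset fun n hn => ⟨Or.inl ?_, hn⟩
      rw [show w n = a from hn]; exact haA
    · refine ((hp2.finite_inter hIf ha.1).union (hq2.finite_inter hJf ha'.1)).subset
        fun n hn => ?_
      exact ((Set.ext_iff.1 hIJ n).2 trivial).imp (fun h => ⟨h, hn⟩) fun h => ⟨h, hn⟩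
  refine ⟨(_, _), Or.inl (Or.inl ⟨?_, p, hp, q, hq, rfl, rfl⟩), hF, hC⟩
  -- The condition `F ∩ C = ∅` is automatic: no event occurs both infinitely and only finitely often
  -- in `w`.
  exact Set.eq_empty_of_forall_notMem fun a ha => hF a ha.1 (hC a ha.2)

/-! ### Soundness of the analysis -/

theorem IsSeqProc.delta_eq {P : Term α} (h : IsSeqProc P) : delta P = deltaSeq P := by
  cases P with
  | DIV | par => exact nomatch h.1
  | var X => exact absurd h.2 (Set.singleton_ne_empty X)
  | STOP | SKIP => rfl
  | _ => exact if_pos h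

theorem IsSeqProc.phi_eq {P : Term α} (h : IsSeqProc P) : Phi P = phiSeq P := by
  cases P with
  | DIV | par => exact nomatch h.1
  | var X => exact absurd h.2 (Set.singleton_ne_empty X)
  | STOP | SKIP => rfl
  | _ => exact if_pos h

theorem seqOr_of_not {β : Type*} {P : Term α} (h : ¬ IsSeqProc P) (x y : β) :
    seqOr P x y = y :=
  if_neg h

/-- The conclusion of the soundness theorem for the process `P`. -/
def Sound (P : Term α) : Prop := (denot P).dv = ∅ ∧ (denot P).FairFor (Phi P)

theorem IsSeqProc.sound [Finite α] {P : Term α} (h : IsSeqProc P) (hδ : delta P = false) :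
    Sound P := by
  rw [h.delta_eq, deltaSeq, decide_eq_false_iff_not] at hδ
  have hc : Convergent P := fun Q hQ hd => hδ ⟨Q, hQ, hd⟩
  refine ⟨Set.eq_empty_of_forall_notMem fun _ => h.notMem_dv hc _ _, ?_⟩
  rw [h.phi_eq]
  exact fun w hw => h.exists_phiSeq hc hw

/-- A term built by a composite rule may itself be a sequential process, in which case its analysis
is read off the transition system and the base case applies. Only otherwise are the compositional
clauses in force; a parallel composition is never sequential. -/
theorem SFS.sound [Finite α] {P : Term α} (hP : SFS P) : delta P = false → Sound P := by
  induction hP with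
  | base hs hc => exact IsSeqProc.sound ⟨hs, hc⟩
  | @pre a P _ ih =>
    intro hδ
    by_cases h : IsSeqProc (.pre a P)
    · exact h.sound hδ
    rw [delta, seqOr_of_not h] at hδ
    obtain ⟨hd, hf⟩ := ih hδ
    rw [Sound, Phi, seqOr_of_not h]
    refine ⟨Set.eq_empty_of_forall_notMem ?_, hf.pre⟩
    rintro _ ⟨s, b, hs, -⟩
    exact (hd ▸ hs : (s, b) ∈ (∅ : Set (Trace α)))
  | @intChoice P Q _ _ ihP ihQ =>
    intro hδ
    by_cases h : IsSeqProc (.intChoice P Q)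
    · exact h.sound hδ
    rw [delta, seqOr_of_not h, Bool.or_eq_false_iff] at hδ
    obtain ⟨hd, hf⟩ := ihP hδ.1
    obtain ⟨hd', hf'⟩ := ihQ hδ.2
    rw [Sound, Phi, seqOr_of_not h]
    exact ⟨Set.union_empty_iff.2 ⟨hd, hd'⟩,
      hf.choice hf' (coherent_denot P) (coherent_denot Q)⟩
  | @extChoice P Q _ _ ihP ihQ =>
    intro hδ
    by_cases h : IsSeqProc (.extChoice P Q)
    · exact h.sound hδ
    rw [delta, seqOr_of_not h, Bool.or_eq_false_iff] at hδ
    obtain ⟨hd, hf⟩ := ihP hδ.1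
    obtain ⟨hd', hf'⟩ := ihQ hδ.2
    rw [Sound, Phi, seqOr_of_not h]
    exact ⟨Set.union_empty_iff.2 ⟨hd, hd'⟩,
      hf.choice hf' (coherent_denot P) (coherent_denot Q)⟩
  | @par A P Q _ _ ihP ihQ =>
    intro hδ
    rw [delta, Bool.or_eq_false_iff] at hδ
    obtain ⟨hd, hf⟩ := ihP hδ.1
    obtain ⟨hd', hf'⟩ := ihQ hδ.2
    rw [Sound, Phi]
    exact ⟨TD.parDv_eq_empty hd hd', hf.par hf' (coherent_denot P) (coherent_denot Q) hd hd'⟩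
  | @seq P Q _ _ ihP ihQ =>
    intro hδ
    by_cases h : IsSeqProc (.seq P Q)
    · exact h.sound hδ
    rw [delta, seqOr_of_not h, Bool.or_eq_false_iff] at hδ
    obtain ⟨hd, hf⟩ := ihP hδ.1
    obtain ⟨hd', hf'⟩ := ihQ hδ.2
    rw [Sound, Phi, seqOr_of_not h]
    refine ⟨Set.eq_empty_of_forall_notMem ?_,
      hf.seq hf' (coherent_denot P) (coherent_denot Q) hd hd'⟩
    rintro _ (hs | ⟨t, s, b, -, hs, -⟩)
    · exact (hd ▸ hs : _ ∈ (∅ : Set (Trace α)))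
    · exact (hd' ▸ hs : _ ∈ (∅ : Set (Trace α)))
  | @hide P A _ ih =>
    intro hδ
    by_cases h : IsSeqProc (.hide P A)
    · exact h.sound hδ
    rw [delta, seqOr_of_not h] at hδ
    split_ifs at hδ with hcond
    obtain ⟨hd, hf⟩ := ih hcond.1
    rw [Sound, Phi, seqOr_of_not h]
    exact ⟨hf.hideDv_eq_empty hd hcond.2, hf.hide (coherent_denot P) hd hcond.2⟩
  | @rename P R _ ih =>
    intro hδ
    by_cases h : IsSeqProc (.rename P R)
    · exact h.sound hδ
    rw [delta, seqOr_of_not h] at hδ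
    obtain ⟨hd, hf⟩ := ih hδ
    rw [Sound, Phi, seqOr_of_not h]
    exact ⟨TD.renameDv_eq_empty hd, hf.rename (coherent_denot P) hd⟩

end CSP

theorem theorem6p1 {α : Type*} [Finite α] (P : CSP.Term α) (hP : CSP.SFS P)
    (hδ : CSP.delta P = false) :
    CSP.LivelockFree P ∧
      ∀ w ∈ CSP.infTraces P, ∃ p ∈ CSP.Phi P, CSP.FairIn w p.1 ∧ CSP.CofairIn w p.2 :=
  hP.sound hδ
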